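/- For $n\in\mathbb N$ let $\beta_n=\sum_{k=0}^{n}\binom nk^2\binom{n+k}k$ be the Apéry numbers, let $H_n=\sum_{k=1}^{n}\frac1k$ be the harmonic numbers, and let $B_0,B_1,B_2,\ldots$ be the Bernoulli numbers, defined by $B_0=1$ and $\sum_{k=0}^{n}\binom{n+1}kB_k=0$ for all $n\ge 1$. For rational numbers $a,b$ and a prime $p$, write $a\equiv b\pmod{p^8}$ if $(a-b)/p^8$ is a rational number whose denominator in lowest terms is not divisible by $p$. Theorem 1.2. For every prime $p>3$, $$\sum_{k=0}^{p-1}(11k^2+13k+4)\beta_k\equiv 4p^2+4p^7B_{p-5}\pmod{p^8},$$ $$\sum_{k=0}^{p-1}(11k^2+9k+2)(-1)^k\beta_k\equiv 2p^2+10p^3H_{p-1}-p^7B_{p-5}\pmod{p^8},$$ and $$\sum_{k=0}^{p-1}(11k^3+7k^2-1)(-1)^k\beta_k\equiv 2p^3-3p^2+(10p-5)p^3H_{p-1}-\frac32p^7B_{p-5}\pmod{p^8}.$$ -/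

import Mathlib

/-- The Apéry numbers `β_n = ∑_{k=0}^n C(n,k)^2 C(n+k,k)`. -/
def aperyBeta (n : ℕ) : ℕ :=
  ∑ k ∈ Finset.range (n + 1), n.choose k ^ 2 * (n + k).choose k

/-- Congruence of rational numbers modulo a natural number `m`: the difference `a - b` is `m`
times a rational number whose denominator (in lowest terms) is coprime to `m`.
For `m = p ^ r` with `p` prime and `r ≥ 1`, this is congruence modulo `p ^ r` in the ring of
`p`-integral rational numbers. -/
def RatModEq (m : ℕ) (a b : ℚ) : Prop :=
  ∃ c : ℚ, c.den.Coprime m ∧ a - b = m * c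

/-! The three-term Apéry recurrence telescopes each of the three sums into `p^2` times a combination
of `β_p` and `β_{p-1}`, so these two numbers are needed only modulo `p^6`: `β_p ≡ 3 + 5pH_{p-1} +
(3/2)p^5 B_{p-5}` and `β_{p-1} ≡ 1 - 5pH_{p-1} + (5/2)p^5 B_{p-5}` (`aperyBeta_prime_congr`,
`aperyBeta_prime_pred_congr`).

Writing binomials as products of `1 ± p/j` gives `β_p = 1 + C(2p,p) + p^2 K(p)`. The dual formula
`aperyBeta_eq_alternating` gives `β_{p-1} = 1 + p^2 K(-p)` with the same kernel `K` (`aperyKernel`).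
Expanding `K` to order four leaves multiple harmonic sums `H(s₁,…,s_r)` over `p > k₁ > ⋯ > k_r > 0`.

These reduce to `H_{p-1}` and `B_{p-5}` by four kinds of relation: quasi-shuffle products; the
reflection `k ↦ p - k`; the alternating binomial transform at `p - 1`, which compares expansions in
`p` with starred sums; and Faulhaber's formula, which gives `H(4,1) ≡ B_{p-5}` and `H(3,2) ≡
-2B_{p-5}` modulo `p`. The prime 5 is checked by computation. -/

open Finset

/-! ### Apéry numbers: dual formula, recurrence, telescoped sums. -/

/-- The dual representation of the Apéry numbers. -/
theorem aperyBeta_eq_alternating (n : ℕ) :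
    (aperyBeta n : ℤ) =
      ∑ k ∈ range (n + 1), (-1) ^ (n - k) * (n.choose k : ℤ) * ((n + k).choose k : ℤ) ^ 2 := by
  have hv : ∀ k, k ≤ n → ((n + k).choose k : ℤ) =
      ∑ j ∈ range (n + 1), (n.choose j : ℤ) * (k.choose j : ℤ) := by
    intro k hk
    rw [Nat.add_choose_eq, Nat.sum_antidiagonal_eq_sum_range_succ_mk]
    push_cast
    calc ∑ j ∈ range (k + 1), (n.choose j : ℤ) * (k.choose (k - j) : ℤ)
        = ∑ j ∈ range (k + 1), (n.choose j : ℤ) * (k.choose j : ℤ) :=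
          sum_congr rfl fun j hj => by
            rw [Nat.choose_symm (by simpa [Nat.lt_succ_iff] using hj)]
      _ = _ := sum_subset (by simpa using hk) fun j _ hj => by
            rw [Nat.choose_eq_zero_of_lt (show k < j by simpa using hj)]
            simp
  -- Since `C(n,k)C(k,j) = C(n,j)C(n-j,k-j)`, this is `C(n,j)` times the `(n-j)`-th forward
  -- difference of `x ↦ C(x,n)` at `n + j`.
  have hd : ∀ j, j ≤ n → ∑ k ∈ range (n + 1), (-1) ^ (n - k) * (n.choose k : ℤ) *
      (k.choose j : ℤ) * ((n + k).choose n : ℤ) = n.choose j * (n + j).choose j := by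
    intro j hj
    obtain ⟨m, rfl⟩ := Nat.exists_eq_add_of_le hj
    have h1 := congrFun (fwdDiff_iter_choose j m) (j + m + j)
    rw [fwdDiff_iter_eq_sum_shift] at h1
    rw [show j + m + 1 = j + (m + 1) by ring, Finset.sum_range_add]
    rw [Finset.sum_eq_zero, zero_add, ← h1, Finset.mul_sum]
    · refine Finset.sum_congr rfl fun i hi => ?_
      have hi' : i ≤ m := by simpa [Nat.lt_succ_iff] using hi
      have h2 : (j + m).choose (j + i) * (j + i).choose j = (j + m).choose j * m.choose i := by
        rw [Nat.choose_mul (by omega : j ≤ j + i)]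
        congr 2 <;> omega
      have h2' : ((j + m).choose (j + i) : ℤ) * (j + i).choose j = (j + m).choose j * m.choose i :=
        mod_cast h2
      rw [show j + m - (j + i) = m - i by omega]
      simp only [smul_eq_mul, mul_one]
      rw [show j + m + (j + i) = j + m + j + i by ring, show m + j = j + m by ring]
      linear_combination (-1) ^ (m - i) * ((j + m + j + i).choose (j + m) : ℤ) * h2'
    · intro i hi
      rw [Nat.choose_eq_zero_of_lt (by simpa using hi : i < j)]
      simp
  calc (aperyBeta n : ℤ) = ∑ j ∈ range (n + 1), (n.choose j : ℤ) * ∑ k ∈ range (n + 1),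
        (-1) ^ (n - k) * (n.choose k : ℤ) * (k.choose j : ℤ) * ((n + k).choose n : ℤ) := by
        rw [aperyBeta]
        push_cast
        refine sum_congr rfl fun j hj => ?_
        rw [hd j (by simpa [Nat.lt_succ_iff] using hj)]
        ring
    _ = _ := by
        simp_rw [Finset.mul_sum]
        rw [Finset.sum_comm]
        refine sum_congr rfl fun k hk => ?_
        have hk' : k ≤ n := by simpa [Nat.lt_succ_iff] using hk
        rw [sq, mul_comm ((n + k).choose k : ℤ), ]
        nth_rw 2 [hv k hk']
        rw [mul_sum, mul_sum]
        refine sum_congr rfl fun j hj => ?_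
        rw [Nat.choose_symm_add (a := n) (b := k)]
        ring

/-- Zeilberger certificate: the recurrence operator applied to the summand is a difference in `k`,
so summation over `k` telescopes. The boundary cases `k = n` and `k = n + 1` are separate because
some binomials vanish there and have no factorial form. -/
theorem aperyBeta_recurrence_term (n k : ℕ) :
    ((n : ℚ) + 2) ^ 2 * ((n + 2).choose (k + 1) ^ 2 * (n + 2 + (k + 1)).choose (k + 1)) -
      (11 * (n + 1) ^ 2 + 11 * (n + 1) + 3) *
        ((n + 1).choose (k + 1) ^ 2 * (n + 1 + (k + 1)).choose (k + 1)) -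
      (n + 1) ^ 2 * (n.choose (k + 1) ^ 2 * (n + (k + 1)).choose (k + 1)) =
    ((k + 1) ^ 2 + 3 * (2 * (n + 1) + 1) * (k + 1) - 11 * (n + 1) ^ 2 - 9 * (n + 1) - 2) *
        ((n + 1).choose (k + 1) ^ 2 * (n + 1 + (k + 1)).choose (k + 1)) -
      (k ^ 2 + 3 * (2 * (n + 1) + 1) * k - 11 * (n + 1) ^ 2 - 9 * (n + 1) - 2) *
        ((n + 1).choose k ^ 2 * (n + 1 + k).choose k) := by
  have f0 := fun n : ℕ => (Nat.cast_ne_zero (R := ℚ)).2 (Nat.factorial_ne_zero n)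
  rcases lt_trichotomy k n with h | rfl | h
  · obtain ⟨m, rfl⟩ := Nat.exists_eq_add_of_lt h
    rw [show k + m + 1 + 2 + (k + 1) = (k + 1) + (k + m + 3) by ring,
      show k + m + 1 + 1 + (k + 1) = (k + 1) + (k + m + 2) by ring,
      show k + m + 1 + (k + 1) = (k + 1) + (k + m + 1) by ring,
      show k + m + 1 + 1 + k = k + (k + m + 2) by ring,
      show k + m + 1 + 2 = (k + 1) + (m + 2) by ring,
      show (k + m + 1 + 1).choose (k + 1) = ((k + 1) + (m + 1)).choose (k + 1) by ring_nf,
      show (k + m + 1 + 1).choose k = (k + (m + 2)).choose k by ring_nf,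
      show (k + m + 1).choose (k + 1) = ((k + 1) + m).choose (k + 1) by ring_nf]
    simp only [Nat.cast_add_choose]
    rw [show k + 1 + (k + 1 + (m + 2)) = (2 * k + m + 2) + 1 + 1 by ring,
      show k + 1 + (k + m + 2) = (2 * k + m + 2) + 1 by ring,
      show k + 1 + (k + m + 1) = (2 * k + m + 2) by ring,
      show k + (k + m + 2) = (2 * k + m + 2) by ring,
      show k + 1 + (m + 2) = (k + m + 1) + 1 + 1 by ring,
      show k + 1 + (m + 1) = (k + m + 1) + 1 by ring,
      show k + (m + 2) = (k + m + 1) + 1 by ring,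
      show k + 1 + m = (k + m + 1) by ring,
      show k + m + 3 = (k + m + 1) + 1 + 1 by ring,
      show k + m + 2 = (k + m + 1) + 1 by ring]
    simp only [Nat.factorial_succ (2 * k + m + 2 + 1), Nat.factorial_succ (2 * k + m + 2),
      Nat.factorial_succ (k + m + 1 + 1), Nat.factorial_succ (k + m + 1), Nat.factorial_succ k,
      Nat.factorial_succ (m + 1), Nat.factorial_succ m]
    push_cast
    have := f0 k; have := f0 m; have := f0 (k + m + 1); have := f0 (2 * k + m + 2)
    field_simp
    ring
  · rw [Nat.choose_succ_self k, Nat.choose_self (k + 1), Nat.choose_succ_self_right,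
      Nat.choose_succ_self_right,
      show k + 2 + (k + 1) = (k + 1) + (k + 2) by ring,
      show k + 1 + k = k + (k + 1) by ring]
    simp only [Nat.cast_add_choose]
    rw [show k + 1 + (k + 2) = (2 * k + 1) + 1 + 1 by ring,
      show k + 1 + (k + 1) = (2 * k + 1) + 1 by ring,
      show k + (k + 1) = 2 * k + 1 by ring]
    simp only [Nat.factorial_succ (2 * k + 1 + 1), Nat.factorial_succ (2 * k + 1),
      Nat.factorial_succ (k + 1), Nat.factorial_succ k]
    push_cast
    have := f0 k; have := f0 (2 * k + 1)
    field_simp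
    ring
  · rcases (show k = n + 1 ∨ n + 1 < k by omega) with rfl | h'
    · rw [Nat.choose_succ_self (n + 1), Nat.choose_eq_zero_of_lt (show n < n + 1 + 1 by omega),
        Nat.choose_self, Nat.choose_self, show n + 1 + 1 = n + 2 by ring]
      simp only [Nat.cast_add_choose]
      rw [show n + 2 + (n + 2) = (2 * n + 2) + 1 + 1 by ring,
        show n + 1 + (n + 1) = 2 * n + 2 by ring]
      simp only [Nat.factorial_succ (2 * n + 2 + 1), Nat.factorial_succ (2 * n + 2),
        Nat.factorial_succ (n + 1), Nat.factorial_succ n]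
      push_cast
      have := f0 n; have := f0 (2 * n + 2)
      field_simp
      ring
    · simp [Nat.choose_eq_zero_of_lt (show n + 2 < k + 1 by omega),
        Nat.choose_eq_zero_of_lt (show n + 1 < k + 1 by omega),
        Nat.choose_eq_zero_of_lt (show n < k + 1 by omega),
        Nat.choose_eq_zero_of_lt (show n + 1 < k by omega)]

theorem aperyBeta_recurrence (n : ℕ) :
    ((n : ℚ) + 2) ^ 2 * aperyBeta (n + 2) =
      (11 * (n + 1) ^ 2 + 11 * (n + 1) + 3) * aperyBeta (n + 1) + (n + 1) ^ 2 * aperyBeta n := by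
  have hext : ∀ m N : ℕ, m ≤ N → (aperyBeta m : ℚ) =
      ∑ k ∈ range (N + 1), ((m.choose k : ℚ) ^ 2 * (m + k).choose k) := by
    intro m N h
    rw [aperyBeta]
    push_cast
    refine sum_subset (by simpa using h) fun k _ hk => ?_
    rw [Nat.choose_eq_zero_of_lt (by simpa using hk)]
    simp
  have key : ∀ N : ℕ, ∑ k ∈ range (N + 1),
      (((n : ℚ) + 2) ^ 2 * ((n + 2).choose k ^ 2 * (n + 2 + k).choose k) -
      (11 * (n + 1) ^ 2 + 11 * (n + 1) + 3) *
        ((n + 1).choose k ^ 2 * (n + 1 + k).choose k) -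
      (n + 1) ^ 2 * (n.choose k ^ 2 * (n + k).choose k)) =
      ((N : ℚ) ^ 2 + 3 * (2 * (n + 1) + 1) * N - 11 * (n + 1) ^ 2 - 9 * (n + 1) - 2) *
        ((n + 1).choose N ^ 2 * (n + 1 + N).choose N) := by
    intro N
    induction N with
    | zero => simp; ring
    | succ N ih =>
      rw [sum_range_succ, ih, aperyBeta_recurrence_term]
      push_cast
      ring
  have h := key (n + 2)
  rw [sum_sub_distrib, sum_sub_distrib, ← mul_sum, ← mul_sum, ← mul_sum,
    ← hext (n + 2) (n + 2) le_rfl, ← hext (n + 1) (n + 2) (by omega), ← hext n (n + 2) (by omega),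
    Nat.choose_succ_self] at h
  push_cast at h
  linear_combination h

/-- The increment of the closed form is the recurrence itself; the two alternating analogues differ
only by a multiplier. At `n = p - 1` the factor `p^2` appears. -/
theorem sum_aperyBeta (n : ℕ) :
    ∑ k ∈ range (n + 1), (11 * (k : ℚ) ^ 2 + 13 * (k : ℚ) + 4) * (aperyBeta k : ℚ) =
      ((n : ℚ) + 1) ^ 2 * ((aperyBeta (n + 1) : ℚ) + aperyBeta n) := by
  induction n with
  | zero => simp [aperyBeta, sum_range_succ]; norm_num
  | succ n ih =>
    rw [sum_range_succ, ih]
    push_cast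
    linear_combination -aperyBeta_recurrence n

theorem alternating_sum_sq_aperyBeta (n : ℕ) :
    ∑ k ∈ range (n + 1),
        (11 * (k : ℚ) ^ 2 + 9 * (k : ℚ) + 2) * (-1 : ℚ) ^ k * (aperyBeta k : ℚ) =
      (-1) ^ n * ((n : ℚ) + 1) ^ 2 * ((aperyBeta (n + 1) : ℚ) - aperyBeta n) := by
  induction n with
  | zero => simp [aperyBeta, sum_range_succ]; norm_num
  | succ n ih =>
    rw [sum_range_succ, ih]
    push_cast
    linear_combination (-1) ^ n * aperyBeta_recurrence n

theorem alternating_sum_cube_aperyBeta (n : ℕ) :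
    ∑ k ∈ range (n + 1),
        (11 * (k : ℚ) ^ 3 + 7 * (k : ℚ) ^ 2 - 1) * (-1 : ℚ) ^ k * (aperyBeta k : ℚ) =
      (-1) ^ n * ((n : ℚ) + 1) ^ 2 *
        (n * (aperyBeta (n + 1) : ℚ) - (n + 1) * aperyBeta n) := by
  induction n with
  | zero => simp [aperyBeta, sum_range_succ]
  | succ n ih =>
    rw [sum_range_succ, ih]
    push_cast
    linear_combination (-1) ^ n * (n + 1) * aperyBeta_recurrence n

/-! ### Multiple harmonic sums: products, symmetric functions, expansions. -/

section MultipleHarmonicSums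

variable {R : Type*} [CommRing R]

/-- Multiple harmonic sums `∑ u k₁ ^ s₁ * u k₂ ^ s₂ * ⋯` over `n > k₁ > k₂ > ⋯`. -/
def mhs (u : ℕ → R) : List ℕ → ℕ → R
  | [], _ => 1
  | s :: l, n => ∑ k ∈ range n, u k ^ s * mhs u l k

/-- The variant of `mhs` with weak inequalities between consecutive indices. -/
def mhsStar (u : ℕ → R) : List ℕ → ℕ → R
  | [], _ => 1
  | s :: l, n => ∑ k ∈ range n, u k ^ s * mhsStar u l (k + 1)

variable (u : ℕ → R)

theorem mhs_nil (n : ℕ) : mhs u [] n = 1 := rfl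

theorem mhs_zero (s : ℕ) (l : List ℕ) : mhs u (s :: l) 0 = 0 := rfl

theorem mhs_succ (s : ℕ) (l : List ℕ) (n : ℕ) :
    mhs u (s :: l) (n + 1) = mhs u (s :: l) n + u n ^ s * mhs u l n :=
  sum_range_succ _ _

theorem mhsStar_nil (n : ℕ) : mhsStar u [] n = 1 := rfl

theorem mhsStar_zero (s : ℕ) (l : List ℕ) : mhsStar u (s :: l) 0 = 0 := rfl

theorem mhsStar_succ (s : ℕ) (l : List ℕ) (n : ℕ) :
    mhsStar u (s :: l) (n + 1) = mhsStar u (s :: l) n + u n ^ s * mhsStar u l (n + 1) :=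
  sum_range_succ _ _

/-- Quasi-shuffle product: two indices are ordered one way, the other way, or coincide. -/
theorem mhs_mul_depth_one (a b n : ℕ) :
    mhs u [a] n * mhs u [b] n = mhs u [a, b] n + mhs u [b, a] n + mhs u [a + b] n := by
  induction n with
  | zero => simp [mhs_zero]
  | succ n ih =>
    simp only [mhs_succ, mhs_nil]
    linear_combination ih

theorem mhs_mul_depth_two (a b c n : ℕ) :
    mhs u [a] n * mhs u [b, c] n = mhs u [a, b, c] n + mhs u [b, a, c] n + mhs u [b, c, a] n +
      mhs u [a + b, c] n + mhs u [b, a + c] n := by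
  induction n with
  | zero => simp [mhs_zero]
  | succ n ih =>
    have h := mhs_mul_depth_one u a c n
    simp only [mhs_succ, mhs_nil]
    linear_combination ih + u n ^ b * h

theorem mhs_one_sq (n : ℕ) : mhs u [1] n ^ 2 = 2 * mhs u [1, 1] n + mhs u [2] n := by
  linear_combination mhs_mul_depth_one u 1 1 n

theorem mhsStar_one (n : ℕ) (s : ℕ) : mhsStar u [s] n = mhs u [s] n := rfl

/-- Newton's identities: `mhsStar u [1, …, 1]` is a complete homogeneous symmetric function of the
`u k`, and `mhs u [s]` is a power sum. -/
theorem two_mul_mhsStar_one_one (n : ℕ) :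
    2 * mhsStar u [1, 1] n = mhs u [1] n ^ 2 + mhs u [2] n := by
  induction n with
  | zero => simp [mhs_zero, mhsStar_zero]
  | succ n ih =>
    simp only [mhsStar_succ, mhsStar_nil, mhs_succ, mhs_nil, mhsStar_one]
    linear_combination ih

theorem three_mul_mhsStar_one_one_one (n : ℕ) :
    3 * mhsStar u [1, 1, 1] n =
      mhs u [1] n * mhsStar u [1, 1] n + mhs u [2] n * mhs u [1] n + mhs u [3] n := by
  induction n with
  | zero => simp [mhs_zero, mhsStar_zero]
  | succ n ih =>
    have h2 := two_mul_mhsStar_one_one u n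
    simp only [mhsStar_succ, mhsStar_nil, mhs_succ, mhs_nil, mhsStar_one]
    linear_combination ih + u n * h2

theorem four_mul_mhsStar_one_one_one_one (n : ℕ) :
    4 * mhsStar u [1, 1, 1, 1] n =
      mhs u [1] n * mhsStar u [1, 1, 1] n + mhs u [2] n * mhsStar u [1, 1] n +
        mhs u [3] n * mhs u [1] n + mhs u [4] n := by
  induction n with
  | zero => simp [mhs_zero, mhsStar_zero]
  | succ n ih =>
    have h2 := two_mul_mhsStar_one_one u n
    have h3 := three_mul_mhsStar_one_one_one u n
    simp only [mhsStar_succ, mhsStar_nil, mhs_succ, mhs_nil, mhsStar_one]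
    linear_combination ih + u n * h3 + u n ^ 2 * h2

theorem mhsStar_one_one_two (n : ℕ) :
    mhsStar u [1, 1, 2] n =
      mhs u [1, 1, 2] n + mhs u [1, 3] n + mhs u [2, 2] n + mhs u [4] n := by
  have h12 : ∀ n, mhsStar u [1, 2] n = mhs u [1, 2] n + mhs u [3] n := by
    intro n
    induction n with
    | zero => simp [mhs_zero, mhsStar_zero]
    | succ n ih =>
      simp only [mhsStar_succ, mhsStar_nil, mhs_succ, mhs_nil, mhsStar_one]
      linear_combination ih
  induction n with
  | zero => simp [mhs_zero, mhsStar_zero]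
  | succ n ih =>
    rw [mhsStar_succ, h12]
    simp only [mhs_succ, mhs_nil]
    linear_combination ih

/-! ### Expansions of weighted sums of products -/

theorem prod_one_sub_expansion (x : R) (n : ℕ) : ∃ c, ∏ j ∈ range n, (1 - x * u j) =
    1 - x * mhs u [1] n + x ^ 2 * mhs u [1, 1] n - x ^ 3 * mhs u [1, 1, 1] n + x ^ 4 * c := by
  induction n with
  | zero => exact ⟨0, by simp [mhs_zero]⟩
  | succ n ih =>
    obtain ⟨c, hc⟩ := ih
    refine ⟨c * (1 - x * u n) + u n * mhs u [1, 1, 1] n, ?_⟩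
    rw [prod_range_succ, hc]
    simp only [mhs_succ, mhs_nil]
    ring

/-- At `x = p` and `n = p` such weighted sums are binomial transforms (`IsRecip.altBinom_pred`). The
product includes `j = k`, whence the merged terms such as `H(3)` next to `H(2,1)`. -/
theorem sum_sq_mul_prod_expansion (x : R) (n : ℕ) :
    ∃ c, ∑ k ∈ range n, (∏ j ∈ range (k + 1), (1 - x * u j)) * u k ^ 2 =
      mhs u [2] n - x * (mhs u [2, 1] n + mhs u [3] n) +
        x ^ 2 * (mhs u [2, 1, 1] n + mhs u [3, 1] n) -
        x ^ 3 * (mhs u [2, 1, 1, 1] n + mhs u [3, 1, 1] n) + x ^ 4 * c := by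
  induction n with
  | zero => exact ⟨0, by simp [mhs_zero]⟩
  | succ n ih =>
    obtain ⟨c, hc⟩ := ih
    obtain ⟨d, hd⟩ := prod_one_sub_expansion u x (n + 1)
    refine ⟨c + d * u n ^ 2, ?_⟩
    rw [sum_range_succ, hc, hd]
    simp only [mhs_succ, mhs_nil]
    ring

theorem sum_pow_four_mul_prod_expansion (x : R) (n : ℕ) :
    ∃ c, ∑ k ∈ range n, (∏ j ∈ range (k + 1), (1 - x * u j)) * u k ^ 4 =
      mhs u [4] n - x * (mhs u [4, 1] n + mhs u [5] n) + x ^ 2 * c := by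
  induction n with
  | zero => exact ⟨0, by simp [mhs_zero]⟩
  | succ n ih =>
    obtain ⟨c, hc⟩ := ih
    obtain ⟨d, hd⟩ := prod_one_sub_expansion u x (n + 1)
    refine ⟨c + (mhs u [1, 1] (n + 1) - x * mhs u [1, 1, 1] (n + 1) + x ^ 2 * d) * u n ^ 4, ?_⟩
    rw [sum_range_succ, hc, hd]
    simp only [mhs_succ, mhs_nil]
    ring

theorem sum_cube_mul_harmonic_mul_prod_expansion (x : R) (n : ℕ) :
    ∃ c, ∑ k ∈ range n, (∏ j ∈ range (k + 1), (1 - x * u j)) * (u k ^ 3 * mhs u [1] (k + 1)) =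
      mhs u [3, 1] n + mhs u [4] n -
        x * (2 * mhs u [3, 1, 1] n + mhs u [3, 2] n + 2 * mhs u [4, 1] n + mhs u [5] n) +
        x ^ 2 * c := by
  induction n with
  | zero => exact ⟨0, by simp [mhs_zero]⟩
  | succ n ih =>
    obtain ⟨c, hc⟩ := ih
    obtain ⟨d, hd⟩ := prod_one_sub_expansion u x (n + 1)
    refine ⟨c + (mhs u [1, 1] (n + 1) - x * mhs u [1, 1, 1] (n + 1) + x ^ 2 * d) *
      (u n ^ 3 * mhs u [1] (n + 1)), ?_⟩
    have h := mhs_one_sq u n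
    rw [sum_range_succ, hc, hd]
    simp only [mhs_succ, mhs_nil]
    linear_combination (-x * u n ^ 3) * h

theorem prod_sq_mul_prod_expansion (x : R) (n : ℕ) :
    ∃ c, (∏ j ∈ range n, (1 - x * u j)) ^ 2 * ∏ j ∈ range n, (1 + x * u j) =
      1 - x * mhs u [1] n + x ^ 2 * (mhs u [1, 1] n - mhs u [2] n) +
        x ^ 3 * (-mhs u [1, 1, 1] n + mhs u [2, 1] n + mhs u [1, 2] n + mhs u [3] n) +
        x ^ 4 * c := by
  induction n with
  | zero => exact ⟨0, by simp [mhs_zero]⟩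
  | succ n ih =>
    obtain ⟨c, hc⟩ := ih
    refine ⟨c * ((1 - x * u n) ^ 2 * (1 + x * u n)) -
      u n * (-mhs u [1, 1, 1] n + mhs u [2, 1] n + mhs u [1, 2] n + mhs u [3] n) -
      u n ^ 2 * (mhs u [1, 1] n - mhs u [2] n) - u n ^ 3 * mhs u [1] n
      + x * (u n ^ 3 * (mhs u [1, 1] n - mhs u [2] n) -
        u n ^ 2 * (-mhs u [1, 1, 1] n + mhs u [2, 1] n + mhs u [1, 2] n + mhs u [3] n))
      + x ^ 2 * u n ^ 3 * (-mhs u [1, 1, 1] n + mhs u [2, 1] n + mhs u [1, 2] n + mhs u [3] n), ?_⟩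
    rw [prod_range_succ, prod_range_succ]
    simp only [mhs_succ, mhs_nil]
    linear_combination (1 - x * u n) ^ 2 * (1 + x * u n) * hc

/-- The sum carrying the terms `0 < k < n` of the Apéry number sums. -/
def aperyKernel (x : R) (n : ℕ) : R :=
  ∑ k ∈ range n, u k ^ 2 * ((∏ j ∈ range k, (1 - x * u j)) ^ 2 *
    ∏ j ∈ range (k + 1), (1 + x * u j))

/-- Order four suffices: the kernel enters with a factor `p^2` and the target is modulo `p^6`. -/
theorem aperyKernel_expansion (x : R) (n : ℕ) :
    ∃ c, aperyKernel u x n = mhs u [2] n + x * (mhs u [3] n - mhs u [2, 1] n) +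
      x ^ 2 * (mhs u [2, 1, 1] n - mhs u [2, 2] n - mhs u [3, 1] n) +
      x ^ 3 * (-mhs u [2, 1, 1, 1] n + mhs u [2, 2, 1] n + mhs u [2, 1, 2] n + mhs u [2, 3] n +
        mhs u [3, 1, 1] n - mhs u [3, 2] n) + x ^ 4 * c := by
  unfold aperyKernel
  induction n with
  | zero => exact ⟨0, by simp [mhs_zero]⟩
  | succ n ih =>
    obtain ⟨c, hc⟩ := ih
    obtain ⟨d, hd⟩ := prod_sq_mul_prod_expansion u x n
    refine ⟨c + u n ^ 2 * (d * (1 + x * u n) +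
      u n * (-mhs u [1, 1, 1] n + mhs u [2, 1] n + mhs u [1, 2] n + mhs u [3] n)), ?_⟩
    rw [sum_range_succ, hc, prod_range_succ (n := n)]
    simp only [mhs_succ, mhs_nil]
    linear_combination u n ^ 2 * (1 + x * u n) * hd

theorem prod_one_sub_sq_expansion (x : R) (n : ℕ) :
    ∃ c, ∏ j ∈ range n, (1 - (x * u j) ^ 2) =
      1 - x ^ 2 * mhs u [2] n + x ^ 4 * mhs u [2, 2] n + x ^ 6 * c := by
  induction n with
  | zero => exact ⟨0, by simp [mhs_zero]⟩
  | succ n ih =>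
    obtain ⟨c, hc⟩ := ih
    refine ⟨c * (1 - (x * u n) ^ 2) - u n ^ 2 * mhs u [2, 2] n, ?_⟩
    rw [prod_range_succ, hc]
    simp only [mhs_succ, mhs_nil]
    ring

end MultipleHarmonicSums

/-! ### Reciprocals, binomial transforms, exact formulas for `β_p` and `β_{p-1}`. -/

section Reciprocals

variable {R : Type*} [CommRing R]

/-- `u` is the sequence of inverses of `1, …, p - 1` in `R`, with `u 0 = 0`. -/
structure IsRecip (p : ℕ) (u : ℕ → R) : Prop where
  zero : u 0 = 0
  mul : ∀ k, 0 < k → k < p → (k : R) * u k = 1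

namespace IsRecip

variable {p : ℕ} {u : ℕ → R} (h : IsRecip p u)
include h

theorem isUnit {k : ℕ} (h0 : 0 < k) (hk : k < p) : IsUnit (k : R) :=
  IsUnit.of_mul_eq_one _ (h.mul k h0 hk)

theorem mul_choose {n k : ℕ} (hn : n + 1 < p) (hk : k < n + 1) :
    (n.choose k : R) * u (k + 1) = u (n + 1) * ((n + 1).choose (k + 1) : R) := by
  have h1 := h.mul (k + 1) (by omega) (by omega)
  have h2 := h.mul (n + 1) (by omega) hn
  have h3 : (((n + 1 : ℕ) * n.choose k : ℕ) : R) = ((n + 1).choose (k + 1) * (k + 1) : ℕ) :=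
    congrArg _ (Nat.add_one_mul_choose_eq n k)
  push_cast at h1 h2 h3
  linear_combination (u (n + 1) * u (k + 1)) * h3 - (n.choose k * u (k + 1)) * h2 +
    ((n + 1).choose (k + 1) * u (n + 1)) * h1

end IsRecip

/-- The alternating binomial transform. -/
def altBinom (f : ℕ → R) (n : ℕ) : R := ∑ k ∈ range (n + 1), (-1) ^ k * (n.choose k : R) * f k

theorem altBinom_succ (f : ℕ → R) (n : ℕ) :
    altBinom f (n + 1) = altBinom f n -
      ∑ k ∈ range (n + 1), (-1) ^ k * (n.choose k : R) * f (k + 1) := by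
  have h1 : altBinom f n = ∑ k ∈ range (n + 1 + 1), (-1) ^ k * (n.choose k : R) * f k := by
    rw [sum_range_succ _ (n + 1), Nat.choose_succ_self]
    simp [altBinom]
  rw [h1, altBinom, sum_range_succ', sum_range_succ' _ (n + 1), add_sub_right_comm,
    ← sum_sub_distrib]
  congr 1
  · refine sum_congr rfl fun k _ => ?_
    rw [Nat.choose_succ_succ]
    push_cast
    ring
  · simp

theorem altBinom_one (n : ℕ) : altBinom (fun _ => (1 : R)) (n + 1) = 0 := by
  rw [altBinom_succ]
  simp [altBinom]

namespace IsRecip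

variable {p : ℕ} {u : ℕ → R} (h : IsRecip p u)
include h

/-- Pascal's rule followed by the absorption identity `C(n,k)/(k+1) = C(n+1,k+1)/(n+1)`. -/
theorem altBinom_mul_succ (f : ℕ → R) {n : ℕ} (hn : n + 1 < p) :
    altBinom (fun k => u k * f k) (n + 1) =
      altBinom (fun k => u k * f k) n + u (n + 1) * (altBinom f (n + 1) - f 0) := by
  rw [altBinom_succ, sub_eq_add_neg]
  congr 1
  unfold altBinom
  rw [sum_range_succ' _ (n + 1)]
  simp only [Nat.choose_zero_right, pow_zero, Nat.cast_one, one_mul, add_sub_cancel_right]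
  rw [mul_sum, ← sum_neg_distrib]
  refine sum_congr rfl fun k hk => ?_
  have := h.mul_choose hn (mem_range.1 hk)
  rw [pow_succ]
  linear_combination (-(-1) ^ k * f (k + 1)) * this

/-- The binomial transform turns division by the index into partial summation. -/
theorem altBinom_mul_eq_neg_mhsStar {f : ℕ → R} {s : ℕ} {l : List ℕ}
    (hf0 : f 0 = 0) (hf : ∀ n < p, altBinom f n = -(u n ^ s * mhsStar u l (n + 1))) :
    ∀ n < p, altBinom (fun k => u k * f k) n = -(u n ^ 0 * mhsStar u ((s + 1) :: l) (n + 1)) := by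
  intro n
  induction n with
  | zero => intro _; simp [altBinom, mhsStar_succ, mhsStar_zero, h.zero]
  | succ n ih =>
    intro hn
    rw [h.altBinom_mul_succ f hn, ih (by omega), hf _ hn, hf0, mhsStar_succ u _ _ (n + 1)]
    ring

/-- The idle factor `u n ^ 0` keeps the shape required by `altBinom_mul_eq_neg_mhsStar`, so each
further factor `u k` prepends a 1 to the index list. -/
theorem altBinom_recip : ∀ n < p, altBinom u n = -(u n ^ 0 * mhsStar u [1] (n + 1)) := by
  intro n
  induction n with
  | zero => intro _; simp [altBinom, mhsStar_succ, mhsStar_zero, h.zero]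
  | succ n ih =>
    intro hn
    have h1 := h.altBinom_mul_succ (fun _ => 1) hn
    simp only [mul_one] at h1
    rw [altBinom_one, show (fun k => u k) = u from rfl, ih (by omega)] at h1
    rw [h1, mhsStar_succ u _ _ (n + 1), mhsStar_nil]
    ring

/-- Starting point of a second chain: the exponent 1 of `u n` makes the first list produced `[2]`,
then `[1, 2]` and `[1, 1, 2]`. -/
theorem altBinom_harmonic :
    ∀ n < p, altBinom (fun k => mhs u [1] (k + 1)) n = -(u n ^ 1 * mhsStar u [] (n + 1)) := by
  intro n hn
  cases n with
  | zero => simp [altBinom, mhs_succ, mhs_zero, h.zero]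
  | succ n =>
    have h2 := altBinom_one (R := R) n
    unfold altBinom at h2
    rw [sum_range_succ'] at h2
    rw [altBinom_succ, altBinom, ← sum_sub_distrib, mhsStar_nil, mul_one, pow_one]
    have h3 : ∀ k ∈ range (n + 1), (-1) ^ k * (n.choose k : R) * mhs u [1] (k + 1) -
        (-1) ^ k * (n.choose k : R) * mhs u [1] (k + 1 + 1) =
        u (n + 1) * ((-1) ^ (k + 1) * ((n + 1).choose (k + 1) : R) * 1) := by
      intro k hk
      have := h.mul_choose hn (mem_range.1 hk)
      rw [mhs_succ u 1 [] (k + 1), mhs_nil, pow_succ]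
      linear_combination (-(-1) ^ k) * this
    rw [sum_congr rfl h3, ← mul_sum]
    simp only [pow_zero, Nat.choose_zero_right, Nat.cast_one, mul_one] at h2 ⊢
    linear_combination u (n + 1) * h2

theorem altBinom_sq {n : ℕ} (hn : n < p) :
    altBinom (fun k => u k ^ 2) n = -mhsStar u [1, 1] (n + 1) := by
  have := h.altBinom_mul_eq_neg_mhsStar h.zero h.altBinom_recip n hn
  simpa [sq] using this

theorem altBinom_pow_four {n : ℕ} (hn : n < p) :
    altBinom (fun k => u k ^ 4) n = -mhsStar u [1, 1, 1, 1] (n + 1) := by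
  have := h.altBinom_mul_eq_neg_mhsStar (by simp [h.zero])
    (h.altBinom_mul_eq_neg_mhsStar (by simp [h.zero])
      (h.altBinom_mul_eq_neg_mhsStar h.zero h.altBinom_recip)) n hn
  convert this using 2
  · ext k; ring
  · simp

theorem altBinom_cube_mul_harmonic {n : ℕ} (hn : n < p) :
    altBinom (fun k => u k ^ 3 * mhs u [1] (k + 1)) n = -mhsStar u [1, 1, 2] (n + 1) := by
  have := h.altBinom_mul_eq_neg_mhsStar (by simp [h.zero])
    (h.altBinom_mul_eq_neg_mhsStar (by simp [h.zero])
      (h.altBinom_mul_eq_neg_mhsStar (by simp [mhs_succ, mhs_zero, h.zero])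
        h.altBinom_harmonic)) n hn
  convert this using 2
  · ext k; ring
  · simp

/-! ### Binomial coefficients as products -/

theorem choose_pred_eq_prod {k : ℕ} (hk : k < p) :
    ((p - 1).choose k : R) = (-1) ^ k * ∏ j ∈ range (k + 1), (1 - p * u j) := by
  induction k with
  | zero => simp [h.zero]
  | succ k ih =>
    have h1 := h.mul (k + 1) (by omega) hk
    have h2 : (((p - 1).choose (k + 1) * (k + 1) : ℕ) : R) = ((p - 1).choose k * (p - 1 - k) : ℕ) :=
      congrArg _ (Nat.choose_succ_right_eq (p - 1) k)
    rw [prod_range_succ, pow_succ]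
    have ih := ih (by omega)
    rw [Nat.cast_mul, Nat.cast_mul, show p - 1 - k = p - (k + 1) by omega,
      Nat.cast_sub hk.le, ih] at h2
    refine (h.isUnit (k := k + 1) (by omega) hk).mul_right_cancel ?_
    linear_combination h2 - ((-1) ^ k * (∏ j ∈ range (k + 1), (1 - p * u j)) * p) * h1

theorem choose_add_eq_prod {k : ℕ} (hk : k < p) :
    ((p + k).choose k : R) = ∏ j ∈ range (k + 1), (1 + p * u j) := by
  induction k with
  | zero => simp [h.zero]
  | succ k ih =>
    have h1 := h.mul (k + 1) (by omega) hk
    have h2 : (((p + k + 1) * (p + k).choose k : ℕ) : R) =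
        ((p + k + 1).choose (k + 1) * (k + 1) : ℕ) :=
      congrArg _ (Nat.add_one_mul_choose_eq (p + k) k)
    rw [prod_range_succ, ← ih (by omega)]
    refine (h.isUnit (k := k + 1) (by omega) hk).mul_right_cancel ?_
    push_cast at h1 h2 ⊢
    linear_combination -h2 - ((p + k).choose k * p) * h1

theorem choose_self_eq_prod {k : ℕ} (h0 : 0 < k) (hk : k < p) :
    (p.choose k : R) = -(-1) ^ k * (p * u k) * ∏ j ∈ range k, (1 - p * u j) := by
  obtain ⟨k, rfl⟩ := Nat.exists_eq_succ_of_ne_zero h0.ne'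
  have h1 := h.mul (k + 1) (by omega) hk
  have h2 : (((p - 1 + 1) * (p - 1).choose k : ℕ) : R) =
      ((p - 1 + 1).choose (k + 1) * (k + 1) : ℕ) :=
    congrArg _ (Nat.add_one_mul_choose_eq (p - 1) k)
  rw [show p - 1 + 1 = p by omega, Nat.cast_mul, h.choose_pred_eq_prod (by omega)] at h2
  refine (h.isUnit (k := k + 1) (by omega) hk).mul_right_cancel ?_
  simp only [Nat.succ_eq_add_one]
  rw [pow_succ]
  push_cast at h1 h2 ⊢
  linear_combination -h2 - ((-1) ^ k * p * ∏ j ∈ range (k + 1), (1 - p * u j)) * h1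

theorem choose_pred_add_eq_prod {k : ℕ} (h0 : 0 < k) (hk : k < p) :
    ((p - 1 + k).choose k : R) = p * u k * ∏ j ∈ range k, (1 + p * u j) := by
  obtain ⟨k, rfl⟩ := Nat.exists_eq_succ_of_ne_zero h0.ne'
  have h1 := h.mul (k + 1) (by omega) hk
  have h2 : (((p + k).choose (k + 1) * (k + 1) : ℕ) : R) = ((p + k).choose k * (p + k - k) : ℕ) :=
    congrArg _ (Nat.choose_succ_right_eq (p + k) k)
  rw [show p + k - k = p by omega, Nat.cast_mul, Nat.cast_mul,
    h.choose_add_eq_prod (by omega)] at h2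
  refine (h.isUnit (k := k + 1) (by omega) hk).mul_right_cancel ?_
  rw [Nat.succ_eq_add_one, show p - 1 + (k + 1) = p + k by omega]
  linear_combination h2 - (p * ∏ j ∈ range (k + 1), (1 + p * u j)) * h1

/-- The sign in `C(p-1,k) = (-1)^k ∏ (1 - p/j)` cancels that of the transform. This links transform
identities to expansions in powers of `p`. -/
theorem altBinom_pred (f : ℕ → R) (hp : 0 < p) :
    altBinom f (p - 1) = ∑ k ∈ range p, (∏ j ∈ range (k + 1), (1 - p * u j)) * f k := by
  rw [altBinom, Nat.sub_add_cancel hp]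
  refine sum_congr rfl fun k hk => ?_
  rw [h.choose_pred_eq_prod (mem_range.1 hk), ← mul_assoc, ← mul_pow]
  simp

/-- The terms `k = 0` and `k = p` give `1` and `C(2p,p)`; for the others `C(p,k)^2` supplies `p^2`.
-/
theorem aperyBeta_prime (hp : 0 < p) :
    (aperyBeta p : R) = 1 + ((p + p).choose p : R) + p ^ 2 * aperyKernel u (p : R) p := by
  rw [aperyBeta]
  push_cast
  rw [sum_range_succ, Nat.choose_self, aperyKernel, mul_sum]
  obtain ⟨q, rfl⟩ := Nat.exists_eq_succ_of_ne_zero hp.ne'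
  rw [sum_range_succ', sum_range_succ' (n := q), h.zero]
  have : ∀ k ∈ range q, ((q + 1).choose (k + 1) : R) ^ 2 *
      ((q + 1 + (k + 1)).choose (k + 1) : R) =
      ((q + 1 : ℕ) : R) ^ 2 * (u (k + 1) ^ 2 *
        ((∏ j ∈ range (k + 1), (1 - ((q + 1 : ℕ) : R) * u j)) ^ 2 *
        ∏ j ∈ range (k + 1 + 1), (1 + ((q + 1 : ℕ) : R) * u j))) := by
    intro k hk
    have hk := mem_range.1 hk
    have hs : ((-1 : R) ^ (k + 1)) ^ 2 = 1 := by rw [← pow_mul, mul_comm, pow_mul]; simp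
    rw [h.choose_self_eq_prod (by omega) (by omega), h.choose_add_eq_prod (by omega)]
    linear_combination (((q + 1 : ℕ) : R) ^ 2 * (u (k + 1) ^ 2 *
      ((∏ j ∈ range (k + 1), (1 - ((q + 1 : ℕ) : R) * u j)) ^ 2 *
        ∏ j ∈ range (k + 1 + 1), (1 + ((q + 1 : ℕ) : R) * u j)))) * hs
  rw [sum_congr rfl this]
  simp
  ring

/-- In the dual formula it is `C(p-1+k,k)^2` that supplies `p^2`; the defining sum would give only
one factor `p` per term. -/
theorem aperyBeta_prime_pred (hp : Odd p) :
    (aperyBeta (p - 1) : R) = 1 + p ^ 2 * aperyKernel u (-p : R) p := by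
  have h1 := congrArg (Int.cast : ℤ → R) (aperyBeta_eq_alternating (p - 1))
  rw [Nat.sub_add_cancel hp.pos] at h1
  push_cast at h1
  rw [h1, aperyKernel, mul_sum]
  obtain ⟨q, rfl⟩ := Nat.exists_eq_succ_of_ne_zero hp.pos.ne'
  have hq : Even q := by simpa [Nat.odd_add_one] using hp
  rw [sum_range_succ', sum_range_succ' (n := q), h.zero]
  have : ∀ k ∈ range q, (-1) ^ (q + 1 - 1 - (k + 1)) * ((q + 1 - 1).choose (k + 1) : R) *
      ((q + 1 - 1 + (k + 1)).choose (k + 1) : R) ^ 2 =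
      ((q + 1 : ℕ) : R) ^ 2 * (u (k + 1) ^ 2 *
      ((∏ j ∈ range (k + 1), (1 - -((q + 1 : ℕ) : R) * u j)) ^ 2 *
        ∏ j ∈ range (k + 1 + 1), (1 + -((q + 1 : ℕ) : R) * u j))) := by
    intro k hk
    have hk := mem_range.1 hk
    have hs : (-1 : R) ^ (q + 1 - 1 - (k + 1)) * (-1 : R) ^ (k + 1) = 1 := by
      rw [← pow_add, show q + 1 - 1 - (k + 1) + (k + 1) = q by omega, hq.neg_one_pow]
    rw [h.choose_pred_eq_prod (by omega), h.choose_pred_add_eq_prod (by omega) (by omega)]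
    simp only [neg_mul, sub_neg_eq_add, ← sub_eq_add_neg]
    linear_combination (((q + 1 : ℕ) : R) ^ 2 * (u (k + 1) ^ 2 *
      ((∏ j ∈ range (k + 1), (1 + ((q + 1 : ℕ) : R) * u j)) ^ 2 *
        ∏ j ∈ range (k + 1 + 1), (1 - ((q + 1 : ℕ) : R) * u j)))) * hs
  rw [show q.succ = q + 1 from rfl, sum_congr rfl this]
  simp [hq.neg_one_pow]
  ring

theorem choose_two_mul_prime (hp : Odd p) :
    ((p + p).choose p : R) = 2 * ∏ j ∈ range p, (1 - (p * u j) ^ 2) := by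
  obtain ⟨q, rfl⟩ := Nat.exists_eq_succ_of_ne_zero hp.pos.ne'
  have hq : Even q := by simpa [Nat.odd_add_one] using hp
  have h1 := h.choose_pred_eq_prod (k := q) (by omega)
  have h2 := h.choose_add_eq_prod (k := q) (by omega)
  rw [hq.neg_one_pow] at h1
  simp only [Nat.succ_eq_add_one, Nat.add_sub_cancel, Nat.choose_self, Nat.cast_one,
    one_mul] at h1 h2 ⊢
  have h3 : (q + 1 + (q + 1)).choose (q + 1) = 2 * (q + 1 + q).choose q := by
    rw [← add_assoc, Nat.choose_succ_succ, two_mul, add_right_inj]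
    exact Nat.choose_symm_of_eq_add (by omega)
  rw [h3]
  push_cast at h1 h2 ⊢
  -- Multiplication by `∏ (1 - p/j) = C(p-1,p-1) = 1` makes the product even in `p`.
  have h4 : ∏ j ∈ range (q + 1), (1 + ((q : R) + 1) * u j) =
      ∏ j ∈ range (q + 1), (1 - (((q : R) + 1) * u j) ^ 2) := by
    rw [← one_mul (∏ j ∈ range (q + 1), (1 + ((q : R) + 1) * u j))]
    nth_rw 1 [h1]
    rw [← prod_mul_distrib]
    exact prod_congr rfl fun j _ => by ring
  rw [h2, h4]

end IsRecip

end Reciprocals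

/-! ### Congruences from reflection, power sums and Faulhaber's formula. -/

section Congruences

variable {R : Type*} [CommRing R]

theorem dvd_sum_sub_sum_of_reflect {p : ℕ} {m : R} {f g : ℕ → R} (hf : f 0 = 0) (hg : g 0 = 0)
    (hfg : ∀ k, 0 < k → k < p → m ∣ f (p - k) - g k) :
    m ∣ ∑ k ∈ range p, f k - ∑ k ∈ range p, g k := by
  cases p with
  | zero => simp
  | succ q =>
    rw [sum_range_succ', sum_range_succ', hf, hg, add_zero, add_zero,
      ← sum_range_reflect (fun k => f (k + 1)), ← sum_sub_distrib]
    refine dvd_sum fun k hk => ?_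
    have hk := mem_range.1 hk
    have := hfg (k + 1) (by omega) (by omega)
    rwa [show q + 1 - (k + 1) = q - 1 - k + 1 by omega] at this

namespace IsRecip

variable {p : ℕ} {u : ℕ → R} (h : IsRecip p u)
include h

/-- Iterating this identity yields the truncated geometric series of `1/(p-k)` in powers of `p/k`.
-/
theorem reflect {k : ℕ} (h0 : 0 < k) (hk : k < p) : u (p - k) = -u k + p * u k * u (p - k) := by
  have h1 := h.mul k h0 hk
  have h2 := h.mul (p - k) (by omega) (by omega)
  rw [Nat.cast_sub hk.le] at h2
  linear_combination -u (p - k) * h1 - u k * h2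

theorem reflect_sq {k : ℕ} (h0 : 0 < k) (hk : k < p) :
    ∃ c, u (p - k) = -(u k + p * u k ^ 2) + (p : R) ^ 2 * c := by
  have h1 := h.reflect h0 hk
  exact ⟨u k ^ 2 * u (p - k), by linear_combination (1 + p * u k) * h1⟩

theorem reflect_cube {k : ℕ} (h0 : 0 < k) (hk : k < p) :
    ∃ c, u (p - k) = -(u k + p * u k ^ 2 + p ^ 2 * u k ^ 3) + (p : R) ^ 3 * c := by
  have h1 := h.reflect h0 hk
  exact ⟨u k ^ 3 * u (p - k), by linear_combination (1 + p * u k + p ^ 2 * u k ^ 2) * h1⟩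

theorem reflect_pow_five {k : ℕ} (h0 : 0 < k) (hk : k < p) :
    ∃ c, u (p - k) = -(u k + p * u k ^ 2 + p ^ 2 * u k ^ 3 + p ^ 3 * u k ^ 4 + p ^ 4 * u k ^ 5) +
      (p : R) ^ 5 * c := by
  have h1 := h.reflect h0 hk
  exact ⟨u k ^ 5 * u (p - k), by
    linear_combination
      (1 + p * u k + p ^ 2 * u k ^ 2 + p ^ 3 * u k ^ 3 + p ^ 4 * u k ^ 4) * h1⟩

theorem two_mul_mhs_one : (p : R) ^ 5 ∣ 2 * mhs u [1] p + p * mhs u [2] p + p ^ 2 * mhs u [3] p +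
    p ^ 3 * mhs u [4] p + p ^ 4 * mhs u [5] p := by
  have := dvd_sum_sub_sum_of_reflect (p := p) (m := (p : R) ^ 5) (f := u)
    (g := fun k => -(u k + p * u k ^ 2 + p ^ 2 * u k ^ 3 + p ^ 3 * u k ^ 4 + p ^ 4 * u k ^ 5))
    h.zero (by simp [h.zero]) (fun k h0 hk => by
      obtain ⟨c, hc⟩ := h.reflect_pow_five h0 hk
      exact ⟨c, by linear_combination hc⟩)
  convert this using 1
  simp only [mhs, sum_neg_distrib, sum_add_distrib, ← mul_sum, mul_one, pow_one]
  ring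

theorem two_mul_mhs_three :
    (p : R) ^ 3 ∣ 2 * mhs u [3] p + 3 * p * mhs u [4] p + 6 * p ^ 2 * mhs u [5] p := by
  have := dvd_sum_sub_sum_of_reflect (p := p) (m := (p : R) ^ 3) (f := fun k => u k ^ 3)
    (g := fun k => -(u k ^ 3 + 3 * p * u k ^ 4 + 6 * p ^ 2 * u k ^ 5))
    (by simp [h.zero]) (by simp [h.zero]) (fun k h0 hk => by
      obtain ⟨c, hc⟩ := h.reflect_cube h0 hk
      have h3 : (p : R) ^ 3 ∣ u (p - k) ^ 3 + (u k + p * u k ^ 2 + p ^ 2 * u k ^ 3) ^ 3 :=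
        (Dvd.intro c (by linear_combination -hc : (p : R) ^ 3 * c =
          u (p - k) + (u k + p * u k ^ 2 + p ^ 2 * u k ^ 3))).trans
          ⟨u (p - k) ^ 2 - u (p - k) * (u k + p * u k ^ 2 + p ^ 2 * u k ^ 3) +
            (u k + p * u k ^ 2 + p ^ 2 * u k ^ 3) ^ 2, by ring⟩
      obtain ⟨d, hd⟩ := h3
      exact ⟨d - (7 * u k ^ 6 + 6 * p * u k ^ 7 + 3 * p ^ 2 * u k ^ 8 + p ^ 3 * u k ^ 9),
        by linear_combination hd⟩)
  convert this using 1
  simp only [mhs, sum_neg_distrib, sum_add_distrib, ← mul_sum, mul_one]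
  ring

theorem mhs_one_reflect {k : ℕ} (hk : k < p) :
    (p : R) ^ 2 ∣ mhs u [1] (p - k) -
      (mhs u [1] p + mhs u [1] (k + 1) + p * mhs u [2] (k + 1)) := by
  induction k with
  | zero => simp [mhs_succ, mhs_zero, h.zero]
  | succ k ih =>
    obtain ⟨d, hd⟩ := ih (by omega)
    obtain ⟨c, hc⟩ := h.reflect_sq (Nat.succ_pos k) hk
    refine ⟨d - c, ?_⟩
    rw [show p - k = p - (k + 1) + 1 by omega, mhs_succ, mhs_nil] at hd
    rw [mhs_succ u 1 [] (k + 1), mhs_succ u 2 [] (k + 1), mhs_nil]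
    linear_combination hd - hc

theorem mhs_two_reflect {k : ℕ} (hk : k < p) :
    (p : R) ∣ mhs u [2] (p - k) - (mhs u [2] p - mhs u [2] (k + 1)) := by
  induction k with
  | zero => simp [mhs_succ, mhs_zero, h.zero]
  | succ k ih =>
    obtain ⟨d, hd⟩ := ih (by omega)
    have hc := h.reflect (Nat.succ_pos k) hk
    refine ⟨d - u (k + 1) * u (p - (k + 1)) * (u (p - (k + 1)) - u (k + 1)), ?_⟩
    rw [show p - k = p - (k + 1) + 1 by omega, mhs_succ, mhs_nil] at hd
    rw [mhs_succ u 2 [] (k + 1), mhs_nil]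
    linear_combination hd - (u (p - (k + 1)) - u (k + 1)) * hc

theorem two_mul_mhs_three_one : (p : R) ^ 2 ∣ 2 * mhs u [3, 1] p + mhs u [4] p +
    p * (mhs u [3, 2] p + mhs u [5] p + 3 * (mhs u [4, 1] p + mhs u [5] p)) +
    mhs u [1] p * (mhs u [3] p + 3 * p * mhs u [4] p) := by
  have := dvd_sum_sub_sum_of_reflect (p := p) (m := (p : R) ^ 2)
    (f := fun k => u k ^ 3 * mhs u [1] k)
    (g := fun k => -(u k ^ 3 + 3 * p * u k ^ 4) *
      (mhs u [1] p + mhs u [1] k + u k) - p * u k ^ 3 * (mhs u [2] k + u k ^ 2))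
    (by simp [h.zero]) (by simp [h.zero]) (fun k h0 hk => by
      obtain ⟨c, hc⟩ := h.reflect_sq h0 hk
      obtain ⟨d, hd⟩ := h.mhs_one_reflect hk
      simp only [mhs_succ, mhs_nil] at hd
      have h3 : (p : R) ^ 2 ∣ u (p - k) ^ 3 + (u k + p * u k ^ 2) ^ 3 :=
        (Dvd.intro c (by linear_combination -hc : (p : R) ^ 2 * c =
          u (p - k) + (u k + p * u k ^ 2))).trans
          ⟨u (p - k) ^ 2 - u (p - k) * (u k + p * u k ^ 2) + (u k + p * u k ^ 2) ^ 2, by ring⟩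
      obtain ⟨e, he⟩ := h3
      refine ⟨u (p - k) ^ 3 * d + (e - (3 * u k ^ 5 + p * u k ^ 6)) *
        (mhs u [1] p + mhs u [1] k + u k + p * (mhs u [2] k + u k ^ 2)) -
        3 * u k ^ 4 * (mhs u [2] k + u k ^ 2), ?_⟩
      linear_combination u (p - k) ^ 3 * hd + he *
        (mhs u [1] p + mhs u [1] k + u k + p * (mhs u [2] k + u k ^ 2)))
  convert this using 1
  have hg : ∀ (z : R) n, ∑ k ∈ range n, (-(u k ^ 3 + 3 * p * u k ^ 4) *
      (z + mhs u [1] k + u k) - p * u k ^ 3 * (mhs u [2] k + u k ^ 2)) =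
      -(mhs u [3, 1] n + mhs u [4] n + z * (mhs u [3] n + 3 * p * mhs u [4] n) +
        3 * p * (mhs u [4, 1] n + mhs u [5] n) + p * (mhs u [3, 2] n + mhs u [5] n)) := by
    intro z n
    induction n with
    | zero => simp [mhs_zero]
    | succ n ih =>
      rw [sum_range_succ, ih]
      simp only [mhs_succ, mhs_nil]
      ring
  rw [hg, show ∑ k ∈ range p, u k ^ 3 * mhs u [1] k = mhs u [3, 1] p from rfl]
  ring

/-- Modulo `p`, reflection swaps `H_{k-1}` and `H_k` and changes the sign of `1/k^3`. Hence the sum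
of `H_{k-1}H_k/k^3` is its own negative; expanding it gives the relation. -/
theorem mhs_three_one_one_reflect (h2 : IsUnit (2 : R)) (h1 : (p : R) ∣ mhs u [1] p) :
    (p : R) ∣ 2 * mhs u [3, 1, 1] p + mhs u [3, 2] p + mhs u [4, 1] p := by
  have := dvd_sum_sub_sum_of_reflect (p := p) (m := (p : R))
    (f := fun k => u k ^ 3 * (mhs u [1] k * mhs u [1] (k + 1)))
    (g := fun k => -(u k ^ 3 * (mhs u [1] k * mhs u [1] (k + 1))))
    (by simp [h.zero]) (by simp [h.zero]) (fun k h0 hk => by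
      have hc := h.reflect h0 hk
      obtain ⟨d, hd⟩ := h.mhs_one_reflect hk
      obtain ⟨e, he⟩ := h.mhs_one_reflect (show k - 1 < p by omega)
      rw [show p - (k - 1) = p - k + 1 by omega, show k - 1 + 1 = k by omega] at he
      obtain ⟨z, hz⟩ := h1
      have hd' : (p : R) ∣ mhs u [1] (p - k) - mhs u [1] (k + 1) :=
        ⟨z + mhs u [2] (k + 1) + p * d, by linear_combination hd + hz⟩
      have he' : (p : R) ∣ mhs u [1] (p - k + 1) - mhs u [1] k :=
        ⟨z + mhs u [2] k + p * e, by linear_combination he + hz⟩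
      obtain ⟨d, hd⟩ := hd'
      obtain ⟨e, he⟩ := he'
      have hc' : (p : R) ∣ u (p - k) ^ 3 + u k ^ 3 :=
        (Dvd.intro (u k * u (p - k)) (by linear_combination -hc : (p : R) * (u k * u (p - k)) =
          u (p - k) + u k)).trans
          ⟨u (p - k) ^ 2 - u (p - k) * u k + u k ^ 2, by ring⟩
      obtain ⟨c, hc⟩ := hc'
      refine ⟨c * (mhs u [1] (p - k) * mhs u [1] (p - k + 1)) -
        u k ^ 3 * (d * mhs u [1] (p - k + 1) + e * mhs u [1] (k + 1)), ?_⟩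
      linear_combination hc * (mhs u [1] (p - k) * mhs u [1] (p - k + 1)) -
        u k ^ 3 * (hd * mhs u [1] (p - k + 1) + he * mhs u [1] (k + 1)))
  rw [sum_neg_distrib, sub_neg_eq_add, ← two_mul, h2.dvd_mul_left] at this
  convert this using 1
  have hg : ∀ n, ∑ k ∈ range n, u k ^ 3 * (mhs u [1] k * mhs u [1] (k + 1)) =
      2 * mhs u [3, 1, 1] n + mhs u [3, 2] n + mhs u [4, 1] n := by
    intro n
    induction n with
    | zero => simp [mhs_zero]
    | succ n ih =>
      have := mhs_one_sq u n
      rw [sum_range_succ, ih]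
      simp only [mhs_succ, mhs_nil]
      linear_combination u n ^ 3 * this
  rw [hg]

/-- The same symmetry for second-order harmonic numbers: reflection swaps the two factors and
negates both, so their product is invariant while `1/k` changes sign. -/
theorem mhs_one_two_two_reflect (h2 : IsUnit (2 : R)) (h1 : (p : R) ∣ mhs u [2] p) :
    (p : R) ∣ 2 * mhs u [1, 2, 2] p + mhs u [1, 4] p + mhs u [3, 2] p := by
  have := dvd_sum_sub_sum_of_reflect (p := p) (m := (p : R))
    (f := fun k => u k * (mhs u [2] k * mhs u [2] (k + 1)))
    (g := fun k => -(u k * (mhs u [2] k * mhs u [2] (k + 1))))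
    (by simp [h.zero]) (by simp [h.zero]) (fun k h0 hk => by
      have hc := h.reflect h0 hk
      obtain ⟨d, hd⟩ := h.mhs_two_reflect hk
      obtain ⟨e, he⟩ := h.mhs_two_reflect (show k - 1 < p by omega)
      rw [show p - (k - 1) = p - k + 1 by omega, show k - 1 + 1 = k by omega] at he
      obtain ⟨z, hz⟩ := h1
      refine ⟨u k * u (p - k) * (mhs u [2] (p - k) * mhs u [2] (p - k + 1)) -
        u k * ((z + d) * mhs u [2] (p - k + 1) - (z + e) * mhs u [2] (k + 1)), ?_⟩
      linear_combination hc * (mhs u [2] (p - k) * mhs u [2] (p - k + 1)) -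
        u k * ((hz + hd) * mhs u [2] (p - k + 1) - (hz + he) * mhs u [2] (k + 1)))
  rw [sum_neg_distrib, sub_neg_eq_add, ← two_mul, h2.dvd_mul_left] at this
  convert this using 1
  have hg : ∀ n, ∑ k ∈ range n, u k * (mhs u [2] k * mhs u [2] (k + 1)) =
      2 * mhs u [1, 2, 2] n + mhs u [1, 4] n + mhs u [3, 2] n := by
    intro n
    induction n with
    | zero => simp [mhs_zero]
    | succ n ih =>
      have := mhs_mul_depth_one u 2 2 n
      rw [sum_range_succ, ih]
      simp only [mhs_succ, mhs_nil]
      linear_combination u n * this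
  rw [hg]

end IsRecip

/-! ### Power sums modulo a prime -/

theorem dvd_sum_range_pow {p : ℕ} (hp : p.Prime) {i : ℕ} (hi : i < p - 1) :
    (p : R) ∣ ∑ k ∈ range p, (k : R) ^ i := by
  have := Fact.mk hp
  have h1 : ((∑ k ∈ range p, k ^ i : ℕ) : ZMod p) = 0 := by
    rw [← FiniteField.sum_pow_lt_card_sub_one (ZMod p) i (by rwa [ZMod.card])]
    push_cast
    refine sum_nbij' (fun k => (k : ZMod p)) ZMod.val ?_ ?_ ?_ ?_ ?_
    · simp
    · intro a _; simpa using ZMod.val_lt a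
    · intro a ha; exact ZMod.val_cast_of_lt (mem_range.1 ha)
    · intro a _; simp
    · simp
  obtain ⟨c, hc⟩ := (ZMod.natCast_eq_zero_iff _ p).1 h1
  refine ⟨c, ?_⟩
  rw [← Nat.cast_mul, ← hc]
  push_cast
  rfl

theorem dvd_pow_pred_sub_one {p : ℕ} (hp : p.Prime) {k : ℕ} (h0 : 0 < k) (hk : k < p) :
    (p : R) ∣ (k : R) ^ (p - 1) - 1 := by
  have h1 : IsCoprime (k : ℤ) p := Nat.isCoprime_iff_coprime.2
    ((Nat.Prime.coprime_iff_not_dvd hp).2 (Nat.not_dvd_of_pos_of_lt h0 hk)).symm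
  obtain ⟨c, hc⟩ := (Int.ModEq.pow_card_sub_one_eq_one hp h1).symm.dvd
  refine ⟨c, ?_⟩
  have := congrArg (Int.cast : ℤ → R) hc
  push_cast at this
  exact this

namespace IsRecip

variable {p : ℕ} {u : ℕ → R} (h : IsRecip p u)
include h

theorem pow_mul_pow_congr (hp : p.Prime) {k b e N : ℕ} (h0 : 0 < k) (hk : k < p)
    (hN : N + b = p - 1 + e) :
    (p : R) ∣ u k ^ b * (k : R) ^ e - (k : R) ^ N := by
  obtain ⟨c, hc⟩ := dvd_pow_pred_sub_one (R := R) hp h0 hk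
  have h1 : (k : R) ^ b * u k ^ b = 1 := by rw [← mul_pow, h.mul k h0 hk, one_pow]
  have h2 : (k : R) ^ N * (k : R) ^ b = (k : R) ^ (p - 1) * (k : R) ^ e := by
    rw [← pow_add, ← pow_add, hN]
  refine ⟨-c * (u k ^ b * (k : R) ^ e), ?_⟩
  linear_combination (k : R) ^ N * h1 - u k ^ b * h2 - (u k ^ b * (k : R) ^ e) * hc

theorem dvd_sum_pow_mul_pow (hp : p.Prime) {b e N : ℕ} (hb : b ≠ 0) (hN0 : N ≠ 0)
    (hN : N + b = p - 1 + e) :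
    (p : R) ∣ ∑ k ∈ range p, u k ^ b * (k : R) ^ e - ∑ k ∈ range p, (k : R) ^ N := by
  rw [← sum_sub_distrib]
  refine dvd_sum fun k hk => ?_
  rcases Nat.eq_zero_or_pos k with rfl | h0
  · simp [h.zero, hb, hN0]
  · exact h.pow_mul_pow_congr hp h0 (mem_range.1 hk) hN

theorem dvd_mhs_depth_one (hp : p.Prime) {m : ℕ} (h0 : 0 < m) (hm : m < p - 1) :
    (p : R) ∣ mhs u [m] p := by
  have h1 := h.dvd_sum_pow_mul_pow hp (b := m) (e := 0) (N := p - 1 - m)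
    h0.ne' (by omega) (by omega)
  have h2 := dvd_sum_range_pow (R := R) hp (i := p - 1 - m) (by omega)
  have h3 := dvd_add h1 h2
  simpa [mhs] using h3

/-- Modulo `p`, replace `1/k^a` by `k^(p-1-a)` and sum over `k < n` by Faulhaber. The remaining
power sums over `n` vanish except for exponent zero, at `r = p - a - b`, which contributes `p - 1 ≡
-1`. The factor `p - a` avoids a division. -/
theorem faulhaber_congr (hp : p.Prime) {a b : ℕ} (ha : 0 < a) (hb : 0 < b) (hab : a + b < p - 1)
    {B : ℕ → R} (hB : ∀ n : ℕ, ((p - a : ℕ) : R) * ∑ k ∈ range n, (k : R) ^ (p - 1 - a) =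
      ∑ r ∈ range (p - a), ((p - a).choose r : R) * B r * (n : R) ^ (p - a - r)) :
    (p : R) ∣ ((p - a : ℕ) : R) * mhs u [b, a] p +
      ((p - a).choose (p - a - b) : R) * B (p - a - b) := by
  have h1 : (p : R) ∣ mhs u [b, a] p -
      ∑ n ∈ range p, u n ^ b * ∑ k ∈ range n, (k : R) ^ (p - 1 - a) := by
    rw [show mhs u [b, a] p = ∑ n ∈ range p, u n ^ b * mhs u [a] n from rfl, ← sum_sub_distrib]
    refine dvd_sum fun n hn => ?_
    rw [← mul_sub]
    refine Dvd.dvd.mul_left ?_ _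
    rw [show mhs u [a] n = ∑ k ∈ range n, u k ^ a * 1 from rfl, ← sum_sub_distrib]
    refine dvd_sum fun k hk => ?_
    rcases Nat.eq_zero_or_pos k with rfl | h0
    · simp [h.zero, ha.ne', show p - 1 - a ≠ 0 by omega]
    · have := h.pow_mul_pow_congr hp (b := a) (e := 0) (N := p - 1 - a) h0
        ((mem_range.1 hk).trans (mem_range.1 hn)) (by omega)
      simpa using this
  have h2 : ((p - a : ℕ) : R) * ∑ n ∈ range p, u n ^ b * ∑ k ∈ range n, (k : R) ^ (p - 1 - a) =
      ∑ r ∈ range (p - a), ((p - a).choose r : R) * B r *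
        ∑ n ∈ range p, u n ^ b * (n : R) ^ (p - a - r) := by
    simp_rw [mul_sum (range p)]
    rw [sum_comm]
    refine sum_congr rfl fun n _ => ?_
    rw [mul_left_comm, hB, mul_sum]
    exact sum_congr rfl fun r _ => by ring
  have h3 : ∀ r ∈ range (p - a), r ≠ p - a - b →
      (p : R) ∣ ∑ n ∈ range p, u n ^ b * (n : R) ^ (p - a - r) := by
    intro r hr hne
    have hr := mem_range.1 hr
    rcases lt_or_gt_of_ne hne with hlt | hgt
    -- Here `N` exceeds `p - 1`; a second use of Fermat lowers the exponent to `p - a - r - b`,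
    -- which lies strictly between `0` and `p - 1`.
    · have h4 := h.dvd_sum_pow_mul_pow hp (b := b) (e := p - a - r) (N := p - 1 + (p - a - r) - b)
        hb.ne' (by omega) (by omega)
      have h5 := h.dvd_sum_pow_mul_pow hp (b := p - 1) (e := p - 1 + (p - a - r) - b)
        (N := p - 1 + (p - a - r) - b) (by omega) (by omega) (by omega)
      have h6 : (p : R) ∣ ∑ n ∈ range p, u n ^ (p - 1) * (n : R) ^ (p - 1 + (p - a - r) - b) := by
        have h7 : ∀ n ∈ range p, u n ^ (p - 1) * (n : R) ^ (p - 1 + (p - a - r) - b) =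
            (n : R) ^ (p - a - r - b) := by
          intro n hn
          rcases Nat.eq_zero_or_pos n with rfl | h0
          · simp [h.zero, show p - 1 ≠ 0 by omega, show p - a - r - b ≠ 0 by omega]
          · rw [show p - 1 + (p - a - r) - b = p - 1 + (p - a - r - b) by omega, pow_add,
              ← mul_assoc, ← mul_pow, mul_comm (u n), h.mul n h0 (mem_range.1 hn), one_pow, one_mul]
        rw [sum_congr rfl h7]
        exact dvd_sum_range_pow hp (by omega)
      have h8 := (dvd_sub_right h6).1 h5
      exact (dvd_sub_left h8).1 h4
    · have h4 := h.dvd_sum_pow_mul_pow hp (b := b) (e := p - a - r) (N := p - 1 + (p - a - r) - b)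
        hb.ne' (by omega) (by omega)
      exact (dvd_sub_left (dvd_sum_range_pow hp (by omega))).1 h4
  have h4 : (p : R) ∣ ∑ n ∈ range p, u n ^ b * (n : R) ^ (p - a - (p - a - b)) + 1 := by
    have h5 : ∀ n ∈ range p, u n ^ b * (n : R) ^ (p - a - (p - a - b)) =
        if n = 0 then 0 else 1 := by
      intro n hn
      rcases Nat.eq_zero_or_pos n with rfl | h0
      · simp [h.zero, hb.ne']
      · rw [show p - a - (p - a - b) = b by omega, ← mul_pow, mul_comm (u n),
          h.mul n h0 (mem_range.1 hn), one_pow, if_neg h0.ne']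
    rw [sum_congr rfl h5]
    obtain ⟨q, rfl⟩ := Nat.exists_eq_succ_of_ne_zero hp.ne_zero
    rw [sum_range_succ']
    simp
  have hmem : p - a - b ∈ range (p - a) := mem_range.2 (by omega)
  have h5 : (p : R) ∣ ∑ r ∈ range (p - a), ((p - a).choose r : R) * B r *
        ∑ n ∈ range p, u n ^ b * (n : R) ^ (p - a - r) +
        ((p - a).choose (p - a - b) : R) * B (p - a - b) := by
    rw [← add_sum_erase _ _ hmem, add_right_comm, ← mul_add_one]
    refine dvd_add (h4.mul_left _) (dvd_sum fun r hr => ?_)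
    exact (h3 r (mem_of_mem_erase hr) (ne_of_mem_erase hr)).mul_left _
  rw [← h2] at h5
  have h6 := dvd_add (h1.mul_left ((p - a : ℕ) : R)) h5
  convert h6 using 1
  ring

end IsRecip

end Congruences

/-! ### Evaluation of the harmonic sums and of `β_p`, `β_{p-1}` modulo `p^6`. -/

section AperyCongruences

variable {R : Type*} [CommRing R]

namespace IsRecip

variable {p : ℕ} {u : ℕ → R} (h : IsRecip p u)
include h

theorem isUnit_two (hp7 : 7 ≤ p) : IsUnit (2 : R) := by
  simpa using h.isUnit (k := 2) (by omega) (by omega)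

theorem isUnit_five (hp7 : 7 ≤ p) : IsUnit (5 : R) := by
  simpa using h.isUnit (k := 5) (by omega) (by omega)

theorem sq_dvd_mhs_one (hp : p.Prime) (hp7 : 7 ≤ p) : (p : R) ^ 2 ∣ mhs u [1] p := by
  obtain ⟨c, hc⟩ := h.two_mul_mhs_one
  obtain ⟨d, hd⟩ := h.dvd_mhs_depth_one hp (m := 2) (by omega) (by omega)
  refine ((h.isUnit_two hp7).dvd_mul_left).1 ⟨p ^ 3 * c - d - mhs u [3] p - p * mhs u [4] p -
    p ^ 2 * mhs u [5] p, ?_⟩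
  linear_combination hc - p * hd

/-- The transform of `1/k^4` equals minus a starred sum, and four times that starred sum is `H(4)`
modulo `p^2` by Newton, as `p^2 ∣ H(1)` and `p` divides both factors of the remaining product. -/
theorem five_mul_mhs_four (hp : p.Prime) (hp7 : 7 ≤ p) :
    (p : R) ^ 2 ∣ 5 * mhs u [4] p - 4 * p * mhs u [4, 1] p := by
  have h1 := h.altBinom_pow_four (n := p - 1) (by omega)
  rw [h.altBinom_pred _ (by omega), Nat.sub_add_cancel (by omega)] at h1
  obtain ⟨c, hc⟩ := sum_pow_four_mul_prod_expansion u (p : R) p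
  have h4 := four_mul_mhsStar_one_one_one_one u p
  have h2 := two_mul_mhsStar_one_one u p
  obtain ⟨a1, e1⟩ := h.sq_dvd_mhs_one hp hp7
  obtain ⟨a2, e2⟩ := h.dvd_mhs_depth_one hp (m := 2) (by omega) (by omega)
  obtain ⟨a5, e5⟩ := h.dvd_mhs_depth_one hp (m := 5) (by omega) (by omega)
  have hs : (p : R) ∣ mhsStar u [1, 1] p := ((h.isUnit_two hp7).dvd_mul_left).1
    ⟨p * a1 * mhs u [1] p + a2, by linear_combination h2 + mhs u [1] p * e1 + e2⟩
  obtain ⟨b, eb⟩ := hs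
  refine ⟨4 * a5 - 4 * c - a1 * mhsStar u [1, 1, 1] p - a2 * b - mhs u [3] p * a1, ?_⟩
  linear_combination 4 * h1 - 4 * hc - h4 + 4 * p * e5 - mhsStar u [1, 1, 1] p * e1 -
    mhsStar u [1, 1] p * e2 - p * a2 * eb - mhs u [3] p * e1

theorem two_mul_mhs_two_two (hp : p.Prime) (hp7 : 7 ≤ p) :
    (p : R) ^ 2 ∣ 2 * mhs u [2, 2] p + mhs u [4] p := by
  obtain ⟨a, ea⟩ := h.dvd_mhs_depth_one hp (m := 2) (by omega) (by omega)
  have hs := mhs_mul_depth_one u 2 2 p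
  exact ⟨a ^ 2, by linear_combination (mhs u [2] p + p * a) * ea - hs⟩

theorem mhs_three_one_add (hp : p.Prime) (hp7 : 7 ≤ p) :
    (p : R) ^ 2 ∣ mhs u [3, 1] p + mhs u [1, 3] p + mhs u [4] p := by
  obtain ⟨a, ea⟩ := h.sq_dvd_mhs_one hp hp7
  have hs := mhs_mul_depth_one u 1 3 p
  exact ⟨a * mhs u [3] p, by linear_combination mhs u [3] p * ea - hs⟩

/-- From the transform of `1/k^2`, with `H(1)^2 ≡ 0` modulo `p^4`. It contains `H(2,1)`, `H(2,1,1)`,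
`H(2,1,1,1)` in the proportions of `K(p)`, so they need not be evaluated there. -/
theorem two_mul_weighted_sum_congr (hp : p.Prime) (hp7 : 7 ≤ p) : (p : R) ^ 4 ∣ 3 * mhs u [2] p
    - 2 * p * (mhs u [2, 1] p + mhs u [3] p) + 2 * p ^ 2 * (mhs u [2, 1, 1] p + mhs u [3, 1] p)
    - 2 * p ^ 3 * (mhs u [2, 1, 1, 1] p + mhs u [3, 1, 1] p) := by
  have h1 := h.altBinom_sq (n := p - 1) (by omega)
  rw [h.altBinom_pred _ (by omega), Nat.sub_add_cancel (by omega)] at h1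
  obtain ⟨k, hk⟩ := sum_sq_mul_prod_expansion u (p : R) p
  have hs := two_mul_mhsStar_one_one u p
  obtain ⟨g, eg⟩ := h.sq_dvd_mhs_one hp hp7
  refine ⟨-2 * k - g ^ 2, ?_⟩
  linear_combination 2 * h1 - 2 * hk - hs - (mhs u [1] p + p ^ 2 * g) * eg

theorem mhs_two_three_congr (hp : p.Prime) (hp7 : 7 ≤ p)
    {q : R} (h32 : (p : R) ∣ mhs u [3, 2] p + 2 * q) :
    (p : R) ∣ mhs u [2, 3] p - 2 * q := by
  obtain ⟨a, ea⟩ := h.dvd_mhs_depth_one hp (m := 2) (by omega) (by omega)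
  obtain ⟨b, eb⟩ := h32
  obtain ⟨c, ec⟩ := h.dvd_mhs_depth_one hp (m := 5) (by omega) (by omega)
  have hs := mhs_mul_depth_one u 2 3 p
  exact ⟨a * mhs u [3] p - b - c, by linear_combination mhs u [3] p * ea - hs - eb - ec⟩

section WithBernoulli

variable (hp : p.Prime) (hp7 : 7 ≤ p) {q : R} (h41 : (p : R) ∣ mhs u [4, 1] p - q)
  (h32 : (p : R) ∣ mhs u [3, 2] p + 2 * q)
include hp hp7 h41

/-- In this section `q` stands for `B_{p-5}`; the integer factors in the statements clear
denominators. -/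
theorem five_mul_mhs_four_congr : (p : R) ^ 2 ∣ 5 * mhs u [4] p - 4 * p * q := by
  obtain ⟨a, ea⟩ := h.five_mul_mhs_four hp hp7
  obtain ⟨b, eb⟩ := h41
  exact ⟨a + 4 * b, by linear_combination ea + 4 * p * eb⟩

theorem ten_mul_mhs_three_congr : (p : R) ^ 3 ∣ 10 * mhs u [3] p + 12 * p ^ 2 * q := by
  obtain ⟨a, ea⟩ := h.five_mul_mhs_four_congr hp hp7 h41
  obtain ⟨b, eb⟩ := h.two_mul_mhs_three
  obtain ⟨c, ec⟩ := h.dvd_mhs_depth_one hp (m := 5) (by omega) (by omega)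
  exact ⟨5 * b - 3 * a - 30 * c, by linear_combination 5 * eb - 3 * p * ea - 30 * p ^ 2 * ec⟩

theorem ten_mul_mhs_two_congr :
    (p : R) ^ 5 ∣ 10 * p * mhs u [2] p + 20 * mhs u [1] p - 4 * p ^ 4 * q := by
  obtain ⟨a, ea⟩ := h.five_mul_mhs_four_congr hp hp7 h41
  obtain ⟨b, eb⟩ := h.ten_mul_mhs_three_congr hp hp7 h41
  obtain ⟨c, ec⟩ := h.dvd_mhs_depth_one hp (m := 5) (by omega) (by omega)
  obtain ⟨d, ed⟩ := h.two_mul_mhs_one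
  exact ⟨10 * d - b - 2 * a - 10 * c, by
    linear_combination 10 * ed - p ^ 2 * eb - 2 * p ^ 3 * ea - 10 * p ^ 4 * ec⟩

theorem mhs_one_four_congr : (p : R) ∣ mhs u [1, 4] p + q := by
  obtain ⟨a, ea⟩ := h.sq_dvd_mhs_one hp hp7
  obtain ⟨b, eb⟩ := h41
  obtain ⟨c, ec⟩ := h.dvd_mhs_depth_one hp (m := 5) (by omega) (by omega)
  have hs := mhs_mul_depth_one u 1 4 p
  exact ⟨p * a * mhs u [4] p - b - c, by linear_combination mhs u [4] p * ea - hs - eb - ec⟩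

theorem five_mul_choose_two_mul_prime :
    (p : R) ^ 6 ∣ 5 * ((p + p).choose p : R) - 10 - 20 * p * mhs u [1] p + 8 * p ^ 5 * q := by
  obtain ⟨c, hc⟩ := prod_one_sub_sq_expansion u (p : R) p
  have hch := h.choose_two_mul_prime (hp.odd_of_ne_two (by omega))
  obtain ⟨a, ea⟩ := h.five_mul_mhs_four_congr hp hp7 h41
  obtain ⟨b, eb⟩ := h.two_mul_mhs_two_two hp hp7
  obtain ⟨d, ed⟩ := h.ten_mul_mhs_two_congr hp hp7 h41
  exact ⟨10 * c - d + 5 * b - a, by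
    linear_combination 5 * hch + 10 * hc - p * ed + 5 * p ^ 4 * eb - p ^ 4 * ea⟩

include h32

theorem ten_mul_mhs_three_one_congr : (p : R) ^ 2 ∣ 10 * mhs u [3, 1] p + 9 * p * q := by
  obtain ⟨a, ea⟩ := h.five_mul_mhs_four_congr hp hp7 h41
  obtain ⟨b, eb⟩ := h.two_mul_mhs_three_one
  obtain ⟨c, ec⟩ := h.dvd_mhs_depth_one hp (m := 5) (by omega) (by omega)
  obtain ⟨d, ed⟩ := h.sq_dvd_mhs_one hp hp7
  obtain ⟨e, ee⟩ := h41
  obtain ⟨f, ef⟩ := h32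
  exact ⟨5 * b - a - 20 * c - 5 * f - 15 * e - 5 * d * (mhs u [3] p + 3 * p * mhs u [4] p), by
    linear_combination 5 * eb - ea - 20 * p * ec - 5 * p * ef - 15 * p * ee -
      5 * (mhs u [3] p + 3 * p * mhs u [4] p) * ed⟩

theorem two_mul_mhs_three_one_one_congr : (p : R) ∣ 2 * mhs u [3, 1, 1] p - q := by
  obtain ⟨a, ea⟩ := h.mhs_three_one_one_reflect (h.isUnit_two hp7)
    (h.dvd_mhs_depth_one hp (by omega) (by omega))
  obtain ⟨e, ee⟩ := h41
  obtain ⟨f, ef⟩ := h32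
  exact ⟨a - e - f, by linear_combination ea - ee - ef⟩

/-- This is the `p^3` coefficient that survives in both kernels. `H(2,2,1) + H(2,1,2)` is traded for
`H(1,2,2)` through `H(1)H(2,2) ≡ 0`, and reflection handles `H(1,2,2)`. -/
theorem weight_five_congr : (p : R) ∣ 2 * (mhs u [3, 2] p - mhs u [2, 3] p - mhs u [2, 2, 1] p -
    mhs u [2, 1, 2] p - 2 * mhs u [3, 1, 1] p) + 7 * q := by
  obtain ⟨a, ea⟩ := h.mhs_one_two_two_reflect (h.isUnit_two hp7)
    (h.dvd_mhs_depth_one hp (by omega) (by omega))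
  obtain ⟨b, eb⟩ := h.mhs_one_four_congr hp hp7 h41
  obtain ⟨c, ec⟩ := h.mhs_two_three_congr hp hp7 h32
  obtain ⟨d, ed⟩ := h.two_mul_mhs_three_one_one_congr hp hp7 h41 h32
  obtain ⟨f, ef⟩ := h32
  obtain ⟨g, eg⟩ := h.sq_dvd_mhs_one hp hp7
  have hs := mhs_mul_depth_two u 1 2 2 p
  exact ⟨a - b + 3 * f - 2 * d - 2 * p * g * mhs u [2, 2] p, by
    linear_combination 2 * hs - 2 * mhs u [2, 2] p * eg + ea - eb + 3 * ef - 2 * ed⟩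

/-- The transform of `H_k/k^3` gives `H(1,1,2)`; subtracting the expansions of `H(1)H(2,1)` and
`H(1)H(1,2)`, both zero modulo `p^2`, passes to `H(2,1,1)`. -/
theorem ten_mul_mhs_two_one_one_congr : (p : R) ^ 2 ∣ 10 * mhs u [2, 1, 1] p - 11 * p * q := by
  have h1 := h.altBinom_cube_mul_harmonic (n := p - 1) (by omega)
  rw [h.altBinom_pred _ (by omega), Nat.sub_add_cancel (by omega), mhsStar_one_one_two] at h1
  obtain ⟨k, hk⟩ := sum_cube_mul_harmonic_mul_prod_expansion u (p : R) p
  have hs1 := mhs_mul_depth_two u 1 2 1 p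
  have hs2 := mhs_mul_depth_two u 1 1 2 p
  obtain ⟨a, ea⟩ := h.five_mul_mhs_four_congr hp hp7 h41
  obtain ⟨b, eb⟩ := h.two_mul_mhs_two_two hp hp7
  obtain ⟨c, ec⟩ := h.mhs_three_one_add hp hp7
  obtain ⟨d, ed⟩ := h.two_mul_mhs_three_one_one_congr hp hp7 h41 h32
  obtain ⟨e, ee⟩ := h.ten_mul_mhs_three_one_congr hp hp7 h41 h32
  obtain ⟨f, ef⟩ := h.dvd_mhs_depth_one hp (m := 5) (by omega) (by omega)
  obtain ⟨g, eg⟩ := h.sq_dvd_mhs_one hp hp7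
  obtain ⟨i, ei⟩ := h32
  obtain ⟨j, ej⟩ := h41
  refine ⟨-10 * k + 10 * (d + i + 2 * j + f) - 5 * b - 2 * a - 5 * c - e
    + 5 * g * (mhs u [2, 1] p - mhs u [1, 2] p), ?_⟩
  linear_combination 10 * h1 - 10 * hk + 10 * p * (ed + ei + 2 * ej + ef) - 5 * eb -
    2 * ea - 5 * ec - ee + 5 * (mhs u [2, 1] p - mhs u [1, 2] p) * eg - 5 * hs1 + 5 * hs2

theorem aperyBeta_prime_congr :
    (p : R) ^ 6 ∣ 2 * ((aperyBeta p : R) - 3 - 5 * p * mhs u [1] p) - 3 * p ^ 5 * q := by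
  obtain ⟨k, hk⟩ := aperyKernel_expansion u (p : R) p
  have hβ := h.aperyBeta_prime hp.pos
  obtain ⟨a, ea⟩ := h.five_mul_choose_two_mul_prime hp hp7 h41
  obtain ⟨b, eb⟩ := h.two_mul_weighted_sum_congr hp hp7
  obtain ⟨c, ec⟩ := h.ten_mul_mhs_two_congr hp hp7 h41
  obtain ⟨d, ed⟩ := h.ten_mul_mhs_three_congr hp hp7 h41
  obtain ⟨e, ee⟩ := h.two_mul_mhs_two_two hp hp7
  obtain ⟨f, ef⟩ := h.five_mul_mhs_four_congr hp hp7 h41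
  obtain ⟨g, eg⟩ := h.ten_mul_mhs_three_one_congr hp hp7 h41 h32
  obtain ⟨i, ei⟩ := h.weight_five_congr hp hp7 h41 h32
  refine (((h.isUnit_two hp7).mul (h.isUnit_five hp7)).dvd_mul_left).1
    ⟨4 * a + 20 * k + 10 * b - c + 4 * d - 10 * e + 2 * f - 4 * g - 10 * i, ?_⟩
  linear_combination 20 * hβ + 20 * p ^ 2 * hk + 4 * ea + 10 * p ^ 2 * eb - p * ec +
    4 * p ^ 3 * ed - 10 * p ^ 4 * ee + 2 * p ^ 4 * ef - 4 * p ^ 4 * eg - 10 * p ^ 5 * ei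

/-- At `-p` the weighted-sum relation is added instead of subtracted: `H(2,1)` and `H(2,1,1,1)`
cancel, but `H(2,1,1)` doubles, which is why its value is needed. -/
theorem aperyBeta_prime_pred_congr :
    (p : R) ^ 6 ∣ 2 * ((aperyBeta (p - 1) : R) - 1 + 5 * p * mhs u [1] p) - 5 * p ^ 5 * q := by
  obtain ⟨k, hk⟩ := aperyKernel_expansion u (-p : R) p
  have hβ := h.aperyBeta_prime_pred (hp.odd_of_ne_two (by omega))
  obtain ⟨b, eb⟩ := h.two_mul_weighted_sum_congr hp hp7
  obtain ⟨c, ec⟩ := h.ten_mul_mhs_two_congr hp hp7 h41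
  obtain ⟨d, ed⟩ := h.ten_mul_mhs_three_congr hp hp7 h41
  obtain ⟨e, ee⟩ := h.two_mul_mhs_two_two hp hp7
  obtain ⟨f, ef⟩ := h.five_mul_mhs_four_congr hp hp7 h41
  obtain ⟨g, eg⟩ := h.ten_mul_mhs_two_one_one_congr hp hp7 h41 h32
  obtain ⟨i, ei⟩ := h.weight_five_congr hp hp7 h41 h32
  refine (((h.isUnit_two hp7).mul (h.isUnit_five hp7)).dvd_mul_left).1
    ⟨20 * k - 10 * b + 5 * c - 4 * d - 10 * e + 2 * f + 4 * g + 10 * i, ?_⟩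
  linear_combination 20 * hβ + 20 * p ^ 2 * hk - 10 * p ^ 2 * eb + 5 * p * ec -
    4 * p ^ 3 * ed - 10 * p ^ 4 * ee + 2 * p ^ 4 * ef + 4 * p ^ 4 * eg + 10 * p ^ 5 * ei

end WithBernoulli

end IsRecip

end AperyCongruences

/-! ### The `p`-integral rationals and the Bernoulli values of `H(4,1)` and `H(3,2)`. -/

/-- The ring of rational numbers whose denominator is coprime to `p`. -/
def coprimeDenSubring (p : ℕ) : Subring ℚ where
  carrier := {x | x.den.Coprime p}
  mul_mem' {a b} ha hb :=
    Nat.Coprime.coprime_dvd_left (Rat.mul_den_dvd a b) (Nat.Coprime.mul_left ha hb)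
  one_mem' := by simp
  add_mem' {a b} ha hb :=
    Nat.Coprime.coprime_dvd_left (Rat.add_den_dvd a b) (Nat.Coprime.mul_left ha hb)
  zero_mem' := by simp
  neg_mem' {a} ha := by simpa using ha

theorem inv_natCast_mem_coprimeDenSubring {p k : ℕ} (hk : k.Coprime p) :
    (k : ℚ)⁻¹ ∈ coprimeDenSubring p := by
  change ((k : ℚ)⁻¹).den.Coprime p
  rw [Rat.inv_natCast_den]
  split_ifs
  · simp
  · exact hk

theorem inv_natCast_mem_coprimeDenSubring_of_lt {p k : ℕ} (hp : p.Prime) (hk : k < p) :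
    (k : ℚ)⁻¹ ∈ coprimeDenSubring p := by
  rcases Nat.eq_zero_or_pos k with rfl | h0
  · simp
  · exact inv_natCast_mem_coprimeDenSubring
      ((Nat.Prime.coprime_iff_not_dvd hp).2 (Nat.not_dvd_of_pos_of_lt h0 hk)).symm

theorem bernoulli_mem_coprimeDenSubring {p n : ℕ} (hp : p.Prime) (hn : n + 1 < p) :
    bernoulli n ∈ coprimeDenSubring p := by
  induction n using Nat.strong_induction_on with
  | _ n ih =>
    have h1 := sum_bernoulli (n + 1)
    rw [sum_range_succ, Nat.choose_succ_self_right] at h1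
    have h2 : bernoulli n = ((n + 1 : ℕ) : ℚ)⁻¹ * ((if n + 1 = 1 then 1 else 0) -
        ∑ k ∈ range n, ((n + 1).choose k : ℚ) * bernoulli k) := by
      rw [← h1, add_sub_cancel_left, inv_mul_cancel_left₀ (by positivity)]
    rw [h2]
    refine mul_mem (inv_natCast_mem_coprimeDenSubring_of_lt hp hn) (sub_mem ?_ (sum_mem ?_))
    · split_ifs
      · exact one_mem _
      · exact zero_mem _
    · intro k hk
      have hk := mem_range.1 hk
      exact mul_mem (natCast_mem _ _) (ih k hk (by omega))

theorem ratModEq_pow_of_dvd {p r : ℕ} {x : coprimeDenSubring p} {a b : ℚ}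
    (hx : ((p : coprimeDenSubring p)) ^ r ∣ x) (hab : a - b = x) : RatModEq (p ^ r) a b := by
  obtain ⟨c, rfl⟩ := hx
  refine ⟨c, Nat.Coprime.pow_right r c.2, ?_⟩
  rw [hab]
  push_cast
  rfl

section

variable {p : ℕ} (hp : p.Prime)

/-- The inverses of `0, …, p - 1` in the ring of `p`-integral rational numbers. -/
def recipSeq (p k : ℕ) (hp : p.Prime) : coprimeDenSubring p :=
  if hk : k < p then ⟨(k : ℚ)⁻¹, inv_natCast_mem_coprimeDenSubring_of_lt hp hk⟩ else 0

theorem coe_recipSeq {k : ℕ} (hk : k < p) : (recipSeq p k hp : ℚ) = (k : ℚ)⁻¹ := by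
  rw [recipSeq, dif_pos hk]

theorem isRecip_recipSeq : IsRecip p (fun k => recipSeq p k hp) where
  zero := by
    ext
    rw [coe_recipSeq hp hp.pos]
    simp
  mul k h0 hk := by
    ext
    push_cast
    rw [coe_recipSeq hp hk]
    exact mul_inv_cancel₀ (by positivity)

theorem coe_mhs_one_recipSeq :
    ((mhs (fun k => recipSeq p k hp) [1] p : coprimeDenSubring p) : ℚ) = harmonic (p - 1) := by
  simp only [harmonic, mhs]
  push_cast
  simp only [pow_one, mul_one]
  obtain ⟨q, rfl⟩ := Nat.exists_eq_succ_of_ne_zero hp.ne_zero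
  rw [sum_range_succ', coe_recipSeq hp hp.pos]
  simp only [Nat.cast_zero, inv_zero, add_zero, Nat.succ_eq_add_one, Nat.add_sub_cancel]
  exact sum_congr rfl fun k hk => by
    rw [coe_recipSeq hp (by have := mem_range.1 hk; omega), Nat.cast_succ]

/-- The Bernoulli numbers of index less than `p - 1` as `p`-integral rational numbers. -/
noncomputable def bernoulliSeq (p r : ℕ) (hp : p.Prime) : coprimeDenSubring p :=
  if hr : r + 1 < p then ⟨bernoulli r, bernoulli_mem_coprimeDenSubring hp hr⟩ else 0

theorem coe_bernoulliSeq {r : ℕ} (hr : r + 1 < p) : (bernoulliSeq p r hp : ℚ) = bernoulli r := by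
  rw [bernoulliSeq, dif_pos hr]

theorem faulhaber_bernoulliSeq {a : ℕ} (ha : 0 < a) (hap : a < p) (n : ℕ) :
    ((p - a : ℕ) : coprimeDenSubring p) *
        ∑ k ∈ range n, (k : coprimeDenSubring p) ^ (p - 1 - a) =
      ∑ r ∈ range (p - a), ((p - a).choose r : coprimeDenSubring p) * bernoulliSeq p r hp *
        (n : coprimeDenSubring p) ^ (p - a - r) := by
  ext
  push_cast
  obtain ⟨m, hm⟩ := Nat.exists_eq_add_of_lt hap
  rw [show p - 1 - a = m by omega, show p - a = m + 1 by omega, sum_range_pow, mul_sum]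
  refine sum_congr rfl fun r hr => ?_
  have hr := mem_range.1 hr
  rw [coe_bernoulliSeq hp (by omega)]
  push_cast
  have : (m : ℚ) + 1 ≠ 0 := by positivity
  field_simp

theorem mhs_four_one_congr (hp7 : 7 ≤ p) : (p : coprimeDenSubring p) ∣
    mhs (fun k => recipSeq p k hp) [4, 1] p - bernoulliSeq p (p - 5) hp := by
  have h := isRecip_recipSeq hp
  obtain ⟨c, hc⟩ := h.faulhaber_congr hp one_pos (show 0 < 4 by omega) (by omega)
    (faulhaber_bernoulliSeq hp one_pos (by omega))
  obtain ⟨d, hd⟩ := prod_one_sub_expansion (fun k => recipSeq p k hp) (p : coprimeDenSubring p) 5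
  have h4 := h.choose_pred_eq_prod (k := 4) (by omega)
  rw [show p - 1 - 4 = p - 5 by omega,
    show (p - 1).choose (p - 5) = (p - 1).choose 4 from
      Nat.choose_symm_of_eq_add (by omega), Nat.cast_sub (by omega), h4, hd] at hc
  set u : ℕ → coprimeDenSubring p := fun k => recipSeq p k hp
  set b := bernoulliSeq p (p - 5) hp
  refine ⟨mhs u [4, 1] p - c + (-mhs u [1] 5 + p * mhs u [1, 1] 5 - p ^ 2 * mhs u [1, 1, 1] 5
    + p ^ 3 * d) * b, ?_⟩
  push_cast at hc
  linear_combination -hc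

theorem mhs_three_two_congr (hp7 : 7 ≤ p) : (p : coprimeDenSubring p) ∣
    mhs (fun k => recipSeq p k hp) [3, 2] p + 2 * bernoulliSeq p (p - 5) hp := by
  have h := isRecip_recipSeq hp
  obtain ⟨c, hc⟩ := h.faulhaber_congr hp two_pos (show 0 < 3 by omega) (by omega)
    (faulhaber_bernoulliSeq hp two_pos (by omega))
  -- Modulo `p` this makes `C(p-2,3) ≡ -4`, so the Faulhaber congruence reads `-2H(3,2) - 4B_{p-5} ≡
  -- 0`.
  have h3 : ((p - 2).choose 3 * 6 : ℕ) = (p - 2) * (p - 3) * (p - 4) := by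
    have e1 := Nat.choose_succ_right_eq (p - 2) 2
    have e2 := Nat.choose_succ_right_eq (p - 2) 1
    have e3 := Nat.choose_succ_right_eq (p - 2) 0
    simp only [Nat.choose_zero_right, zero_add, one_mul, mul_one, Nat.sub_zero] at e1 e2 e3
    rw [e3, show p - 2 - 1 = p - 3 by omega] at e2
    rw [show p - 2 - 2 = p - 4 by omega] at e1
    rw [← e2]
    linarith
  have h3' := congrArg (Nat.cast : ℕ → coprimeDenSubring p) h3
  rw [show p - 2 - 3 = p - 5 by omega,
    show (p - 2).choose (p - 5) = (p - 2).choose 3 from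
      Nat.choose_symm_of_eq_add (by omega), Nat.cast_sub (by omega)] at hc
  push_cast [Nat.cast_sub (show 2 ≤ p by omega), Nat.cast_sub (show 3 ≤ p by omega),
    Nat.cast_sub (show 4 ≤ p by omega)] at h3' hc
  set u : ℕ → coprimeDenSubring p := fun k => recipSeq p k hp
  set b := bernoulliSeq p (p - 5) hp
  set z := mhs u [3, 2] p
  have h6 : IsUnit (6 : coprimeDenSubring p) := by
    simpa using h.isUnit (k := 6) (by omega) (by omega)
  have h2 : IsUnit (2 : coprimeDenSubring p) := h.isUnit_two hp7
  refine ((h6.mul h2).dvd_mul_left).1 ⟨6 * z - 6 * c + (p ^ 2 - 9 * p + 26) * b, ?_⟩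
  linear_combination -6 * hc + b * h3'

end

/-! ### Assembly of the three congruences. -/

theorem theorem1p2 (p : ℕ) (hp : p.Prime) (hp3 : 3 < p) :
    RatModEq (p ^ 8)
      (∑ k ∈ Finset.range p, (11 * (k : ℚ) ^ 2 + 13 * (k : ℚ) + 4) * (aperyBeta k : ℚ))
      (4 * (p : ℚ) ^ 2 + 4 * (p : ℚ) ^ 7 * bernoulli (p - 5)) ∧
    RatModEq (p ^ 8)
      (∑ k ∈ Finset.range p,
        (11 * (k : ℚ) ^ 2 + 9 * (k : ℚ) + 2) * (-1 : ℚ) ^ k * (aperyBeta k : ℚ))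
      (2 * (p : ℚ) ^ 2 + 10 * (p : ℚ) ^ 3 * harmonic (p - 1)
        - (p : ℚ) ^ 7 * bernoulli (p - 5)) ∧
    RatModEq (p ^ 8)
      (∑ k ∈ Finset.range p,
        (11 * (k : ℚ) ^ 3 + 7 * (k : ℚ) ^ 2 - 1) * (-1 : ℚ) ^ k * (aperyBeta k : ℚ))
      (2 * (p : ℚ) ^ 3 - 3 * (p : ℚ) ^ 2
        + (10 * (p : ℚ) - 5) * (p : ℚ) ^ 3 * harmonic (p - 1)
        - 3 / 2 * (p : ℚ) ^ 7 * bernoulli (p - 5)) := by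
  obtain ⟨n, rfl⟩ : ∃ n, p = n + 1 := ⟨p - 1, by omega⟩
  have hodd : Odd (n + 1) := hp.odd_of_ne_two (by omega)
  have hn : Even n := by simpa [Nat.odd_add_one] using hodd
  rw [sum_aperyBeta, alternating_sum_sq_aperyBeta, alternating_sum_cube_aperyBeta, hn.neg_one_pow,
    Nat.add_sub_cancel]
  -- The general argument divides by 5, so `p = 5` is computed directly; the witnesses are the
  -- differences divided by `5^8`.
  by_cases h5 : n + 1 = 5
  · obtain rfl : n = 4 := by omega
    have b5 : aperyBeta 5 = 11253 := by decide +kernel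
    have b4 : aperyBeta 4 = 1251 := by decide +kernel
    have hH : harmonic 4 = 25 / 12 := by norm_num [harmonic, sum_range_succ]
    rw [b5, b4, hH]
    norm_num
    exact ⟨⟨0, by simp, by norm_num⟩, ⟨5 / 6, by norm_num, by norm_num⟩,
      ⟨11 / 4, by norm_num, by norm_num⟩⟩
  · have hp7 : 7 ≤ n + 1 := by
      by_contra hlt
      obtain rfl | rfl : n = 3 ∨ n = 5 := by omega
      · exact absurd hp (by norm_num)
      · exact absurd hp (by norm_num)
    have h := isRecip_recipSeq hp
    have hA := h.aperyBeta_prime_congr hp hp7 (mhs_four_one_congr hp hp7)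
      (mhs_three_two_congr hp hp7)
    have hB := h.aperyBeta_prime_pred_congr hp hp7 (mhs_four_one_congr hp hp7)
      (mhs_three_two_congr hp hp7)
    have hH := coe_mhs_one_recipSeq hp
    have hb := coe_bernoulliSeq (r := n + 1 - 5) hp (by omega)
    rw [Nat.add_sub_cancel] at hH hB
    set H := mhs (fun k => recipSeq (n + 1) k hp) [1] (n + 1)
    set b := bernoulliSeq (n + 1) (n + 1 - 5) hp
    rw [← hH, ← hb]
    have e2 : ((2 : coprimeDenSubring (n + 1)) : ℚ) = 2 := rfl
    have e3 : ((3 : coprimeDenSubring (n + 1)) : ℚ) = 3 := rfl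
    have e5 : ((5 : coprimeDenSubring (n + 1)) : ℚ) = 5 := rfl
    obtain ⟨v, hv⟩ := (h.isUnit_two hp7).exists_right_inv
    have hv' : (v : ℚ) = 1 / 2 := by
      have := congrArg (fun x : coprimeDenSubring (n + 1) => (x : ℚ)) hv
      push_cast [e2] at this
      linear_combination this / 2
    obtain ⟨c, hc⟩ := hA
    obtain ⟨d, hd⟩ := hB
    have hc' := congrArg (fun x : coprimeDenSubring (n + 1) => (x : ℚ)) hc
    have hd' := congrArg (fun x : coprimeDenSubring (n + 1) => (x : ℚ)) hd
    push_cast [e2, e3, e5] at hc' hd'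
    -- `v` is `1/2`. In the third witness, `-2 * b` absorbs the leftover `-p^8 B_{p-5}` from
    -- `(p-1)·(3/2) - p·(5/2) = -3/2 - p`.
    refine ⟨ratModEq_pow_of_dvd (Dvd.intro (v * (c + d)) rfl) ?_,
      ratModEq_pow_of_dvd (Dvd.intro (v * (c - d)) rfl) ?_,
      ratModEq_pow_of_dvd (Dvd.intro (v * (n * c - (n + 1) * d - 2 * b)) rfl) ?_⟩
    · push_cast [e2]
      rw [hv']
      linear_combination ((n : ℚ) + 1) ^ 2 / 2 * (hc' + hd')
    · push_cast [e2]
      rw [hv']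
      linear_combination ((n : ℚ) + 1) ^ 2 / 2 * (hc' - hd')
    · push_cast [e2]
      rw [hv']
      linear_combination ((n : ℚ) + 1) ^ 2 / 2 * (n * hc' - (n + 1) * hd')
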